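/- Let $\Theta$ be a finite set of states with $|\Theta|\ge 3$. A prior is a probability distribution $\pi$ on $\Theta$ with full support. An experiment $P=(P_\theta)_{\theta\in\Theta}$ assigns to each state a probability distribution on a finite outcome space $\Omega$; put $P_\pi=\sum_\theta \pi(\theta)P_\theta$ and, for $P_\pi(\omega)>0$, $p_\omega(\theta)=\pi(\theta)P_\theta(\omega)/P_\pi(\omega)$. Let $\phi:[0,\infty)\to[0,\infty]$ be lower semicontinuous and strictly convex on its effective domain $\operatorname{dom}\phi=\{t : \phi(t)<\infty\}$, with $\phi(1)=0$, $1\in\operatorname{ri}(\operatorname{dom}\phi)$, $\lim_{t\to\infty}\phi(t)/t=+\infty$ and $\operatorname{dom}\phi\ne\{1\}$. Suppose that its conjugate $\psi(t)=\phi^\star(t)=\sup_{s\ge0}\,(ts-\phi(s))$ (which is finite for every $t\in\mathbb R$) is three times continuously differentiable on $\mathbb R$. For a prior $\pi$, the Csiszár information cost is $$C_{\phi,\pi}(P)=\inf_{\alpha\in\Delta(\Omega)}\sum_{\omega\in\Omega}\alpha(\omega)\sum_{\theta\in\Theta}\pi(\theta)\,\phi\!\left(\frac{P_\theta(\omega)}{\alpha(\omega)}\right),$$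 where a term with $\alpha(\omega)=0$ is read through the recession function (so it is $0$ if $P_\theta(\omega)=0$ for all $\theta$, and $+\infty$ otherwise). It is posterior separable at $\pi$ if there is a convex, lower semicontinuous $H:\Delta(\Theta)\to[0,\infty]$ with $H(\pi)=0$ and $C_{\phi,\pi}(P)=\sum_{\omega:P_\pi(\omega)>0}P_\pi(\omega)H(p_\omega)$ for all experiments $P$ on all finite outcome spaces. Mutual information is $I_{\mathrm S}^\pi(P)=\sum_\theta\pi(\theta)\sum_\omega P_\theta(\omega)\log\frac{P_\theta(\omega)}{P_\pi(\omega)}$. Then: 1. For every prior $\pi$, $C_{\phi,\pi}$ is posterior separable at $\pi$ if and only if it is proportional to mutual information, i.e. there is $\kappa>0$ with $C_{\phi,\pi}(P)=\kappa I_{\mathrm S}^\pi(P)$ for all experiments $P$. 2. $C_{\phi,\pi}$ is posterior separable at every prior $\pi$ on $\Theta$ if and only if there is $\kappa>0$ such that $\psi(t)=\kappa(e^{t/\kappa}-1)$ for all $t\in\mathbb R$. 3. For every $\kappa>0$: $C_{\phi,\pi}=\kappa I_{\mathrm S}^\pi$ for every prior $\pi$ on $\Theta$ if and only if $\psi(t)=\kappa(e^{t/\kappa}-1)$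 for all $t\in\mathbb R$. -/

import Mathlib

open scoped NNReal ENNReal Topology

namespace RationalInattention

/-- An experiment with state space `Θ` and finite outcome space `Ω`: a probability distribution
over `Ω` for every state. -/
abbrev Experiment (Θ Ω : Type*) [Fintype Ω] := Θ → stdSimplex ℝ≥0 Ω

/-- A cost function assigns a cost in `[0, ∞]` to every experiment with finite outcome space. -/
abbrev CostFunction (Θ : Type*) := ∀ (Ω : Type) [Fintype Ω], Experiment Θ Ω → ℝ≥0∞

/-- The distribution `π` is a full-support prior over the states. -/
def IsPrior {Θ : Type*} [Fintype Θ] (π : Θ → ℝ≥0) : Prop :=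
  π ∈ stdSimplex ℝ≥0 Θ ∧ ∀ θ, 0 < π θ

section Costs

variable {Θ Ω : Type*} [Fintype Θ] [Fintype Ω]

/-- The unconditional distribution `P_π(ω) = ∑ θ, π(θ) P_θ(ω)`. -/
noncomputable def unconditional (π : Θ → ℝ≥0) (P : Experiment Θ Ω) (ω : Ω) : ℝ≥0 :=
  ∑ θ, π θ * (P θ).1 ω

/-- The posterior `p_ω(θ) = P_θ(ω) π(θ) / P_π(ω)`, for `ω` in the support of `P_π`. -/
noncomputable def posterior (π : Θ → ℝ≥0) (P : Experiment Θ Ω) (ω : Ω) (θ : Θ) : ℝ≥0 :=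
  (P θ).1 ω * π θ / unconditional π P ω

/-- The recession function of `f` at `x`, the limit of `f (y + t x) / t` as `t → ∞`, for any `y`
in the effective domain of `f`. The base point is `y = 1`, where the transformations `f` that
generate divergences vanish. For convex `f` the limit exists, so that it equals this upper limit. -/
noncomputable def recession (f : (Θ → ℝ≥0) → ℝ≥0∞) (x : Θ → ℝ≥0) : ℝ≥0∞ :=
  Filter.limsup (fun t : ℝ≥0 => f (1 + t • x) / (t : ℝ≥0∞)) Filter.atTop

/-- The multivariate `f`-divergence `D_f(P ‖ α) = ∑ ω, α(ω) f(P(ω) / α(ω))`, where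
`0 f(x / 0)` stands for the recession function of `f` at `x`. -/
noncomputable def fDivergence (f : (Θ → ℝ≥0) → ℝ≥0∞) (P : Experiment Θ Ω)
    (α : stdSimplex ℝ≥0 Ω) : ℝ≥0∞ :=
  ∑ ω, if α.1 ω = 0 then recession f (fun θ => (P θ).1 ω)
    else (α.1 ω : ℝ≥0∞) * f (fun θ => (P θ).1 ω / α.1 ω)

/-- The `f`-information `I_f(P) = inf_α D_f(P ‖ α)`. -/
noncomputable def fInformation (f : (Θ → ℝ≥0) → ℝ≥0∞) (P : Experiment Θ Ω) : ℝ≥0∞ :=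
  ⨅ α : stdSimplex ℝ≥0 Ω, fDivergence f P α

/-- The additively separable transformation `f(x) = ∑ θ, π(θ) φ(x(θ))`. -/
noncomputable def separable (π : Θ → ℝ≥0) (φ : ℝ≥0 → ℝ≥0∞) (x : Θ → ℝ≥0) : ℝ≥0∞ :=
  ∑ θ, (π θ : ℝ≥0∞) * φ (x θ)

/-- Shannon's mutual information `I_S(P) = ∑ θ, π(θ) ∑ ω, P_θ(ω) log (P_θ(ω) / P_π(ω))`.
For a full-support prior, `P_π(ω) = 0` forces `P_θ(ω) = 0`, and the summand is then zero, in line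
with the convention `0 log (0 / 0) = 0`. -/
noncomputable def mutualInformation (π : Θ → ℝ≥0) (P : Experiment Θ Ω) : ℝ :=
  ∑ θ, (π θ : ℝ) * ∑ ω, ((P θ).1 ω : ℝ) *
    Real.log (((P θ).1 ω : ℝ) / (unconditional π P ω : ℝ))

/-- The cost `C_H(P) = ∑ ω ∈ supp P_π, P_π(ω) H(p_ω)`. -/
noncomputable def posteriorSeparableCost (π : Θ → ℝ≥0) (H : (Θ → ℝ≥0) → ℝ≥0∞)
    (P : Experiment Θ Ω) : ℝ≥0∞ :=
  ∑ ω with unconditional π P ω ≠ 0, (unconditional π P ω : ℝ≥0∞) * H (posterior π P ω)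

end Costs

section CostProperties

variable {Θ : Type*} [Fintype Θ]

/-- An entropy: a convex, lower semicontinuous function on the simplex with values in `[0, ∞]`
that vanishes at the prior. The values of `H` off the simplex play no role. -/
structure IsEntropy (π : Θ → ℝ≥0) (H : (Θ → ℝ≥0) → ℝ≥0∞) : Prop where
  convex : ConvexOn ℝ≥0 (stdSimplex ℝ≥0 Θ) H
  lsc : LowerSemicontinuousOn H (stdSimplex ℝ≥0 Θ)
  prior : H π = 0

/-- Given the prior `π`, the cost `C` is posterior separable. -/
def IsPosteriorSeparable (π : Θ → ℝ≥0) (C : CostFunction Θ) : Prop :=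
  ∃ H : (Θ → ℝ≥0) → ℝ≥0∞, IsEntropy π H ∧
    ∀ (Ω : Type) [Fintype Ω] (P : Experiment Θ Ω), C Ω P = posteriorSeparableCost π H P

/-- Given the prior `π`, the cost `C` is `κ` times mutual information. In particular it is finite
on every experiment. -/
def IsMultipleOfMutualInformation (π : Θ → ℝ≥0) (κ : ℝ) (C : CostFunction Θ) : Prop :=
  ∀ (Ω : Type) [Fintype Ω] (P : Experiment Θ Ω),
    ((C Ω P : ℝ≥0∞) : EReal) = ((κ * mutualInformation π P : ℝ) : EReal)

/-- The Csiszár information cost generated by `φ` at the prior `π`. -/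
noncomputable def csiszarCost (π : Θ → ℝ≥0) (φ : ℝ≥0 → ℝ≥0∞) : CostFunction Θ :=
  fun _ _ P => fInformation (separable π φ) P

end CostProperties

/-- The standing assumption on the univariate transformation `φ : ℝ₊ → [0, ∞]`. -/
structure IsCsiszarTransformation (φ : ℝ≥0 → ℝ≥0∞) : Prop where
  strictConvex : StrictConvexOn ℝ≥0 {t | φ t ≠ ⊤} φ
  lsc : LowerSemicontinuous φ
  one : φ 1 = 0
  one_mem : (1 : ℝ) ∈ intrinsicInterior ℝ ((fun t : ℝ≥0 => (t : ℝ)) '' {t | φ t ≠ ⊤})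
  cofinite : Filter.Tendsto (fun t : ℝ≥0 => φ t / (t : ℝ≥0∞)) Filter.atTop (𝓝 ⊤)

/-- The conjugate `φ⋆(t) = sup_{s ≥ 0} (t s - φ(s))`, as an extended real number. -/
noncomputable def conjugate (φ : ℝ≥0 → ℝ≥0∞) (t : ℝ) : EReal :=
  ⨆ s : ℝ≥0, ((t * (s : ℝ) : ℝ) : EReal) - ((φ s : ℝ≥0∞) : EReal)

/-- The conjugate `ψ = φ⋆` as a real function; see `coe_psi`. -/
noncomputable def psi (φ : ℝ≥0 → ℝ≥0∞) (t : ℝ) : ℝ := (conjugate φ t).toReal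

/-- Under the standing assumption the conjugate is finite everywhere, so that `psi` is `φ⋆`. -/
theorem coe_psi {φ : ℝ≥0 → ℝ≥0∞} (hφ : IsCsiszarTransformation φ) (t : ℝ) :
    ((psi φ t : ℝ) : EReal) = conjugate φ t := by
  refine EReal.coe_toReal ?_ ?_
  · have h := (ENNReal.tendsto_nhds_top_iff_nnreal.1 hφ.cofinite) (Real.toNNReal t)
    obtain ⟨S, hS⟩ := Filter.eventually_atTop.1 h
    have hle : conjugate φ t ≤ ((|t| * ((S : ℝ) + 1) : ℝ) : EReal) := by
      refine iSup_le fun s => ?_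
      rcases le_total s (S + 1) with hs | hs
      · have h0 : ((t * (s : ℝ) : ℝ) : EReal) - ((φ s : ℝ≥0∞) : EReal)
            ≤ ((t * (s : ℝ) : ℝ) : EReal) := by
          simpa using EReal.sub_le_sub (le_refl ((t * (s : ℝ) : ℝ) : EReal))
            (EReal.coe_ennreal_nonneg (φ s))
        refine h0.trans ?_
        refine EReal.coe_le_coe_iff.2 ?_
        have hs' : (s : ℝ) ≤ S + 1 := by exact_mod_cast hs
        calc t * s ≤ |t| * s := by gcongr; exact le_abs_self t
          _ ≤ _ := by gcongr
      · have hs0 : s ≠ 0 := by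
          intro h0
          rw [h0] at hs
          exact absurd hs (by simp)
        have h1 := hS s (le_trans (by simp) hs)
        have h2 : ((t.toNNReal * s : ℝ≥0) : ℝ≥0∞) ≤ φ s := by
          rw [ENNReal.lt_div_iff_mul_lt (Or.inl (by simpa using hs0)) (Or.inl (by simp))] at h1
          push_cast
          exact h1.le
        have h3 : ((t * (s : ℝ) : ℝ) : EReal) ≤ ((φ s : ℝ≥0∞) : EReal) := by
          refine le_trans ?_ (EReal.coe_ennreal_le_coe_ennreal_iff.2 h2)
          rw [EReal.coe_nnreal_eq_coe_real]
          refine EReal.coe_le_coe_iff.2 ?_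
          push_cast
          gcongr
          exact Real.le_coe_toNNReal t
        refine (EReal.sub_nonpos.2 h3).trans ?_
        exact_mod_cast (by positivity : (0 : ℝ) ≤ |t| * ((S : ℝ) + 1))
    exact ne_top_of_le_ne_top (EReal.coe_ne_top _) hle
  · have hle : ((t : ℝ) : EReal) ≤ conjugate φ t := by
      refine le_trans ?_ (le_iSup _ (1 : ℝ≥0))
      simp [hφ.one]
    exact ne_bot_of_le_ne_bot (EReal.coe_ne_bot _) hle

end RationalInattention

open RationalInattention

open RationalInattention

open Filter Set InformationTheory

namespace RationalInattention

/-! ### Fenchel–Young duality between `φ` and its conjugate `ψ` -/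

section Conjugate

variable {φ : ℝ≥0 → ℝ≥0∞}

/-! Posterior separability makes the cost a sum over outcomes of a homogeneous function of the
likelihoods. Mixing two experiments on disjoint outcome spaces then mixes their costs, so the
mixture of optimal references is again optimal (`IsOptimal.mix`). Moving reference mass between
outcomes of different experiments cannot pay, and one Lagrange multiplier `l` serves all experiments
(`exists_isTiltedMin`). Strict convexity makes the optimal mass `a` of a nonzero likelihood vector
`x` unique. Since masses total one, `a` is additive, hence linear: `a = ∑ c θ * x θ`
(`exists_linear_isTiltedMin`).

By duality, `x θ = ψ' (v θ)` has mass one whenever `∑ π θ * ψ (v θ) = l`. So `∑ c θ * ψ' (v θ) = 1`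
on that level set wherever `x ≠ 0`, and Lagrange's rule gives `c θ * ψ'' (v θ) = μ * π θ * ψ' (v
θ)`. With three states, one coordinate moves down, a second restores the constraint and a third pins
`μ`. Hence `ψ'' = k ψ'` to the left of `l`, which forces `k > 0`, `l = 0` and `c = π`
(`exists_eq_of_linear_level`). Moving one state up against all the others extends the exponential
form to `k t < log (1 / π i)` (`psi_eq_exp_of_isOutcomeAdditive`).

At a given prior this range suffices, because `P_θ(ω) / P_π(ω) ≤ 1 / π θ`: the reference `P_π`
bounds the cost above by `k⁻¹` times mutual information, and Fenchel–Young bounds it below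
(`isMultipleOfMutualInformation_of_psi`). Priors with ever smaller weights exhaust the real line,
which gives the global statements. -/

theorem IsCsiszarTransformation.exists_mul_le (hφ : IsCsiszarTransformation φ) (M : ℝ≥0) :
    ∃ S : ℝ≥0, 1 ≤ S ∧ ∀ s, S ≤ s → ((M * s : ℝ≥0) : ℝ≥0∞) ≤ φ s := by
  obtain ⟨S, hS⟩ := eventually_atTop.1 ((ENNReal.tendsto_nhds_top_iff_nnreal.1 hφ.cofinite) M)
  refine ⟨max S 1, le_max_right _ _, fun s hs => ?_⟩
  have hs0 : s ≠ 0 := (zero_lt_one.trans_le ((le_max_right _ _).trans hs)).ne'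
  have h1 := hS s ((le_max_left _ _).trans hs)
  rw [ENNReal.lt_div_iff_mul_lt (Or.inl (by simpa using hs0)) (Or.inl (by simp))] at h1
  push_cast
  exact h1.le

/-- The Fenchel–Young inequality. -/
theorem IsCsiszarTransformation.young (hφ : IsCsiszarTransformation φ) (t : ℝ) {s : ℝ≥0}
    (hs : φ s ≠ ⊤) : t * s ≤ (φ s).toReal + psi φ t := by
  have h := le_iSup (fun s : ℝ≥0 => ((t * (s : ℝ) : ℝ) : EReal) - ((φ s : ℝ≥0∞) : EReal)) s
  change _ ≤ conjugate φ t at h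
  rw [← coe_psi hφ t, ← EReal.coe_toENNReal (EReal.coe_ennreal_nonneg (φ s))] at h
  simp only [EReal.toENNReal_coe] at h
  rw [← ENNReal.ofReal_toReal hs, EReal.coe_ennreal_ofReal, max_eq_left ENNReal.toReal_nonneg,
    ← EReal.coe_sub, EReal.coe_le_coe_iff] at h
  linarith

/-- The Fenchel–Young inequality in `[0, ∞]`. -/
theorem IsCsiszarTransformation.young_ofReal (hφ : IsCsiszarTransformation φ) (t : ℝ) (s : ℝ≥0) :
    ENNReal.ofReal (t * s - psi φ t) ≤ φ s := by
  by_cases hs : φ s = ⊤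
  · simp [hs]
  · refine ENNReal.ofReal_le_of_le_toReal ?_
    linarith [hφ.young t hs]

/-- The supremum in the definition of the conjugate is attained. -/
theorem IsCsiszarTransformation.exists_eq (hφ : IsCsiszarTransformation φ) (t : ℝ) :
    ∃ s : ℝ≥0, φ s ≠ ⊤ ∧ t * s = (φ s).toReal + psi φ t := by
  -- With slope `2|t|`, every `s ≥ S` has `φ s - t s ≥ |t| s ≥ -t`, the value at `s = 1`, so the
  -- minimum over `[0, S]` is global.
  obtain ⟨S, hS1, hS⟩ := hφ.exists_mul_le (2 * ‖t‖₊)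
  -- The shift by `|t| S` keeps the real part nonnegative on `[0, S]`, so `φ s - t s` can be
  -- minimized inside `[0, ∞]`.
  have hlsc : LowerSemicontinuous fun s : ℝ≥0 => φ s + ENNReal.ofReal (|t| * S - t * s) :=
    hφ.lsc.add (Continuous.lowerSemicontinuous
      (ENNReal.continuous_ofReal.comp (by fun_prop)))
  obtain ⟨s₀, hs₀, hmin⟩ := LowerSemicontinuousOn.exists_isMinOn
    (⟨1, zero_le, hS1⟩ : (Icc 0 S).Nonempty) isCompact_Icc (hlsc.lowerSemicontinuousOn _)
  have hnonneg : ∀ s : ℝ≥0, s ≤ S → 0 ≤ |t| * S - t * s := fun s hs => by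
    have h1 : (s : ℝ) ≤ S := by exact_mod_cast hs
    have h2 : t * s ≤ |t| * s := by gcongr; exact le_abs_self t
    have h3 : |t| * s ≤ |t| * S := by gcongr
    linarith
  have h1 := hmin (⟨zero_le, hS1⟩ : (1 : ℝ≥0) ∈ Icc 0 S)
  simp only [hφ.one, zero_add, mem_ofPred_eq] at h1
  have hfin : φ s₀ ≠ ⊤ := by
    intro h
    simp [h] at h1
  have hle : ∀ s : ℝ≥0, s ≤ S → φ s ≠ ⊤ →
      (φ s₀).toReal - t * s₀ ≤ (φ s).toReal - t * s := fun s hs hs' => by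
    have h2 := hmin (⟨zero_le, hs⟩ : s ∈ Icc 0 S)
    simp only [mem_ofPred_eq] at h2
    have h3 := ENNReal.toReal_mono (by finiteness) h2
    rw [ENNReal.toReal_add hfin (by finiteness), ENNReal.toReal_add hs' (by finiteness),
      ENNReal.toReal_ofReal (hnonneg _ hs₀.2), ENNReal.toReal_ofReal (hnonneg _ hs)] at h3
    linarith
  have hle1 : (φ s₀).toReal - t * s₀ ≤ - t := by
    have := hle 1 hS1 (by simp [hφ.one])
    simpa [hφ.one] using this
  refine ⟨s₀, hfin, le_antisymm (hφ.young t hfin) ?_⟩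
  have : conjugate φ t ≤ ((t * s₀ - (φ s₀).toReal : ℝ) : EReal) := by
    refine iSup_le fun s => ?_
    by_cases hs' : φ s = ⊤
    · simp [hs']
    have e : ((φ s : ℝ≥0∞) : EReal) = ((φ s).toReal : EReal) := by
      conv_lhs => rw [← ENNReal.ofReal_toReal hs', EReal.coe_ennreal_ofReal,
        max_eq_left ENNReal.toReal_nonneg]
    rw [e, ← EReal.coe_sub, EReal.coe_le_coe_iff]
    rcases le_total s S with hs | hs
    · linarith [hle s hs hs']
    · have h4 := ENNReal.toReal_mono hs' (hS s hs)
      simp only [ENNReal.coe_toReal, NNReal.coe_mul, NNReal.coe_ofNat, coe_nnnorm,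
        Real.norm_eq_abs] at h4
      have h5 : t * s ≤ |t| * s := by gcongr; exact le_abs_self t
      have h6 : |t| * 1 ≤ |t| * s := by gcongr; exact_mod_cast hS1.trans hs
      have h7 := neg_abs_le t
      linarith
  rw [← coe_psi hφ t, EReal.coe_le_coe_iff] at this
  linarith

/-- Equality in Fenchel–Young makes `t` a global minimum of `u ↦ ψ u - u s`. -/
theorem IsCsiszarTransformation.eq_deriv (hφ : IsCsiszarTransformation φ)
    (hd : Differentiable ℝ (psi φ)) {t : ℝ} {s : ℝ≥0} (hs : φ s ≠ ⊤)
    (h : t * s = (φ s).toReal + psi φ t) : deriv (psi φ) t = s := by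
  have hmin : IsLocalMin (fun u => psi φ u - u * s) t := by
    refine Eventually.of_forall fun u => ?_
    have := hφ.young u hs
    linarith
  have hder : HasDerivAt (fun u => psi φ u - u * s) (deriv (psi φ) t - 1 * s) t :=
    (hd t).hasDerivAt.sub ((hasDerivAt_id t).mul_const _)
  have := hmin.hasDerivAt_eq_zero hder
  linarith

theorem IsCsiszarTransformation.exists_deriv (hφ : IsCsiszarTransformation φ)
    (hd : Differentiable ℝ (psi φ)) (t : ℝ) :
    ∃ s : ℝ≥0, deriv (psi φ) t = s ∧ φ s ≠ ⊤ ∧ t * s = (φ s).toReal + psi φ t := by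
  obtain ⟨s, hs, h⟩ := hφ.exists_eq t
  exact ⟨s, hφ.eq_deriv hd hs h, hs, h⟩

theorem IsCsiszarTransformation.deriv_nonneg (hφ : IsCsiszarTransformation φ)
    (hd : Differentiable ℝ (psi φ)) (t : ℝ) : 0 ≤ deriv (psi φ) t := by
  obtain ⟨s, hs, -⟩ := hφ.exists_deriv hd t
  rw [hs]
  exact s.2

theorem IsCsiszarTransformation.monotone_psi (hφ : IsCsiszarTransformation φ)
    (hd : Differentiable ℝ (psi φ)) : Monotone (psi φ) :=
  monotone_of_deriv_nonneg hd (hφ.deriv_nonneg hd)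

/-- Comparing the two Fenchel–Young equalities with the crossed inequalities gives `(u - t) (r - s)
≥ 0`. -/
theorem IsCsiszarTransformation.monotone_deriv (hφ : IsCsiszarTransformation φ)
    (hd : Differentiable ℝ (psi φ)) : Monotone (deriv (psi φ)) := by
  intro t u htu
  obtain ⟨s, hs, hs', h⟩ := hφ.exists_deriv hd t
  obtain ⟨r, hr, hr', h'⟩ := hφ.exists_deriv hd u
  have h1 := hφ.young t hr'
  have h2 := hφ.young u hs'
  rcases htu.eq_or_lt with rfl | htu
  · exact le_rfl
  rw [hs, hr]
  nlinarith

/-- The hypothesis says that the line of slope `t` through `(1, 0)` supports `φ`, so `s = 1` attains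
the supremum. -/
theorem IsCsiszarTransformation.psi_eq_self (hφ : IsCsiszarTransformation φ) {t : ℝ}
    (h : ∀ s, φ s ≠ ⊤ → t * (s - 1) ≤ (φ s).toReal) : psi φ t = t := by
  refine le_antisymm ?_ (by simpa [hφ.one] using hφ.young t (s := 1) (by simp [hφ.one]))
  obtain ⟨s, hs, h'⟩ := hφ.exists_eq t
  linarith [h s hs]

theorem IsCsiszarTransformation.deriv_eq_one (hφ : IsCsiszarTransformation φ)
    (hd : Differentiable ℝ (psi φ)) {t : ℝ} (h : psi φ t = t) : deriv (psi φ) t = 1 := by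
  have := hφ.eq_deriv hd (t := t) (s := 1) (by simp [hφ.one]) (by simp [hφ.one, h])
  simpa using this

theorem IsCsiszarTransformation.psi_zero (hφ : IsCsiszarTransformation φ) : psi φ 0 = 0 :=
  hφ.psi_eq_self fun s _ => by simp

/-- The effective domain contains points on both sides of `1`. -/
theorem IsCsiszarTransformation.exists_lt_one_lt (hφ : IsCsiszarTransformation φ)
    (h : ∃ t : ℝ≥0, t ≠ 1 ∧ φ t ≠ ⊤) : ∃ r s : ℝ≥0, r < 1 ∧ 1 < s ∧ φ r ≠ ⊤ ∧ φ s ≠ ⊤ := by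
  obtain ⟨t, ht1, ht⟩ := h
  set D : Set ℝ := (fun t : ℝ≥0 => (t : ℝ)) '' {t | φ t ≠ ⊤}
  obtain ⟨y, hy, hy1⟩ := mem_intrinsicInterior.1 hφ.one_mem
  have htD : (t : ℝ) ∈ affineSpan ℝ D := subset_affineSpan ℝ D ⟨t, ht, rfl⟩
  have h1D : (1 : ℝ) ∈ affineSpan ℝ D := hy1 ▸ y.2
  -- The relative interior is open in the affine span, so the line through `1` and `t` stays in the
  -- domain for a while on both sides of `1`.
  let g : ℝ → affineSpan ℝ D := fun x =>
    ⟨AffineMap.lineMap (1 : ℝ) (t : ℝ) x, AffineMap.lineMap_mem x h1D htD⟩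
  have hg : Continuous g := by
    refine Continuous.subtype_mk ?_ _
    exact AffineMap.lineMap_continuous
  have hg0 : g 0 = y := Subtype.ext (by simp [g, hy1])
  have hev : ∀ᶠ x in 𝓝 (0 : ℝ), (g x : ℝ) ∈ D := by
    have := hg.continuousAt.preimage_mem_nhds
      (t := ((↑) ⁻¹' D : Set (affineSpan ℝ D))) (x := 0) (by
        rw [hg0]; exact mem_interior_iff_mem_nhds.1 hy)
    exact this
  obtain ⟨ε, hε, hball⟩ := Metric.eventually_nhds_iff.1 hev
  have hp := hball (y := ε / 2) (by rw [Real.dist_eq, sub_zero, abs_of_pos (by positivity)]; linarith)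
  have hn := hball (y := -(ε / 2)) (by
    rw [Real.dist_eq, sub_zero, abs_neg, abs_of_pos (by positivity)]; linarith)
  obtain ⟨a, ha, ha'⟩ := hp
  obtain ⟨b, hb, hb'⟩ := hn
  simp only [g, AffineMap.lineMap_apply, vsub_eq_sub, smul_eq_mul, vadd_eq_add] at ha' hb'
  rcases lt_or_gt_of_ne ht1 with h1 | h1
  · have h1' : (t : ℝ) < 1 := by exact_mod_cast h1
    refine ⟨a, b, ?_, ?_, ha, hb⟩
    · rw [← NNReal.coe_lt_coe]; push_cast; nlinarith
    · rw [← NNReal.coe_lt_coe]; push_cast; nlinarith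
  · have h1' : 1 < (t : ℝ) := by exact_mod_cast h1
    refine ⟨b, a, ?_, ?_, hb, ha⟩
    · rw [← NNReal.coe_lt_coe]; push_cast; nlinarith
    · rw [← NNReal.coe_lt_coe]; push_cast; nlinarith

theorem IsCsiszarTransformation.ne_top_of_mem_Icc (hφ : IsCsiszarTransformation φ) {r s t : ℝ≥0}
    (hr : φ r ≠ ⊤) (hs : φ s ≠ ⊤) (h1 : r ≤ t) (h2 : t ≤ s) : φ t ≠ ⊤ := by
  have hconv := hφ.strictConvex.1
  rcases h1.eq_or_lt with rfl | h1
  · exact hr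
  have hrs : r < s := h1.trans_le h2
  have hpos : 0 < s - r := tsub_pos_of_lt hrs
  have := hconv hr hs (a := (s - t) / (s - r)) (b := (t - r) / (s - r)) zero_le zero_le (by
    rw [← add_div, tsub_add_tsub_cancel h2 h1.le, div_self hpos.ne'])
  convert this using 2
  congr! 1
  rw [smul_eq_mul, smul_eq_mul, ← NNReal.coe_inj]
  have : (s : ℝ) - r ≠ 0 := by
    have : (r : ℝ) < s := by exact_mod_cast hrs
    linarith
  push_cast [NNReal.coe_sub h2, NNReal.coe_sub h1.le, NNReal.coe_sub hrs.le]
  field_simp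
  ring

end Conjugate

/-- The contribution `a f(x / a)` of an outcome to the divergence, read through the recession
function for `a = 0`, where `f` is the additively separable transformation. -/
noncomputable def perspective {Θ : Type*} [Fintype Θ] (π : Θ → ℝ≥0) (φ : ℝ≥0 → ℝ≥0∞) (a : ℝ≥0)
    (x : Θ → ℝ≥0) : ℝ≥0∞ :=
  if a = 0 then recession (separable π φ) x else (a : ℝ≥0∞) * separable π φ (fun θ => x θ / a)

/-! ### The contribution of one outcome as a function of its reference mass -/

section Perspective

variable {Θ : Type*} [Fintype Θ] {π : Θ → ℝ≥0} {φ : ℝ≥0 → ℝ≥0∞}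

theorem fDivergence_separable_eq {Ω : Type*} [Fintype Ω] (P : Experiment Θ Ω)
    (α : stdSimplex ℝ≥0 Ω) :
    fDivergence (separable π φ) P α = ∑ ω, perspective π φ (α.1 ω) (fun θ => (P θ).1 ω) := rfl

theorem perspective_of_ne_zero {a : ℝ≥0} (ha : a ≠ 0) (x : Θ → ℝ≥0) :
    perspective π φ a x = a * separable π φ (fun θ => x θ / a) := if_neg ha

theorem perspective_one (x : Θ → ℝ≥0) : perspective π φ 1 x = separable π φ x := by
  simp [perspective]

theorem ofReal_sum_le {ι : Type*} (s : Finset ι) (f : ι → ℝ) :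
    ENNReal.ofReal (∑ i ∈ s, f i) ≤ ∑ i ∈ s, ENNReal.ofReal (f i) :=
  Finset.le_sum_of_subadditive _ (by simp) (fun _ _ => ENNReal.ofReal_add_le) s f

theorem ofReal_le_separable (hφ : IsCsiszarTransformation φ) (v : Θ → ℝ) (x : Θ → ℝ≥0) :
    ENNReal.ofReal (∑ θ, (π θ : ℝ) * (v θ * x θ - psi φ (v θ))) ≤ separable π φ x := by
  refine (ofReal_sum_le _ _).trans (Finset.sum_le_sum fun θ _ => ?_)
  rw [ENNReal.ofReal_mul (π θ).coe_nonneg, ENNReal.ofReal_coe_nnreal]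
  gcongr
  exact hφ.young_ofReal _ _

/-- Fenchel–Young at `x θ / a`, averaged and multiplied by `a`, gives a bound jointly linear in `(a,
x)`, which survives at `a = 0`. It is the source of the dual estimates below. -/
theorem ofReal_le_perspective (hφ : IsCsiszarTransformation φ) (v : Θ → ℝ) (a : ℝ≥0)
    (x : Θ → ℝ≥0) :
    ENNReal.ofReal (∑ θ, (π θ : ℝ) * (v θ * x θ) - a * ∑ θ, (π θ : ℝ) * psi φ (v θ))
      ≤ perspective π φ a x := by
  rcases eq_or_ne a 0 with rfl | ha
  · simp only [perspective, if_true, NNReal.coe_zero, zero_mul, sub_zero]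
    set A := ∑ θ, (π θ : ℝ) * (v θ * x θ)
    set B := ∑ θ, (π θ : ℝ) * (v θ * 1 - psi φ (v θ))
    -- The bound at `1 + t x`, divided by `t`, loses its constant part `B` in the limit.
    have hlim : Tendsto (fun t : ℝ≥0 => ENNReal.ofReal (B * (t : ℝ)⁻¹ + A)) atTop
        (𝓝 (ENNReal.ofReal A)) := by
      refine ENNReal.tendsto_ofReal ?_
      have h1 : Tendsto (fun t : ℝ≥0 => B * (t : ℝ)⁻¹) atTop (𝓝 (B * 0)) :=
        (tendsto_inv_atTop_zero.comp (NNReal.tendsto_coe_atTop.2 tendsto_id)).const_mul _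
      simpa using h1.add_const A
    rw [← hlim.limsup_eq]
    refine limsup_le_limsup ?_
    filter_upwards [eventually_gt_atTop 0] with t ht
    have ht' : (0 : ℝ) < t := by exact_mod_cast ht
    rw [ENNReal.le_div_iff_mul_le (Or.inl (by simpa using ht.ne')) (Or.inl (by simp)),
      ← ENNReal.ofReal_coe_nnreal (p := t), ← ENNReal.ofReal_mul' t.coe_nonneg]
    refine le_trans (le_of_eq ?_) (ofReal_le_separable hφ v _)
    congr 1
    simp only [Pi.add_apply, Pi.one_apply, Pi.smul_apply, smul_eq_mul, NNReal.coe_add,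
      NNReal.coe_one, NNReal.coe_mul]
    rw [add_mul, mul_assoc, inv_mul_cancel₀ ht'.ne', mul_one, Finset.sum_mul,
      ← Finset.sum_add_distrib]
    exact Finset.sum_congr rfl fun θ _ => by ring
  · rw [perspective_of_ne_zero ha]
    have ha' : (a : ℝ) ≠ 0 := by exact_mod_cast ha
    refine le_trans (le_of_eq ?_) (mul_le_mul_right (ofReal_le_separable hφ v _) _)
    rw [← ENNReal.ofReal_coe_nnreal (p := a), ← ENNReal.ofReal_mul a.coe_nonneg, Finset.mul_sum,
      Finset.mul_sum, ← Finset.sum_sub_distrib]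
    congr 1
    refine Finset.sum_congr rfl fun θ _ => ?_
    push_cast
    field_simp

theorem le_toReal_perspective (hφ : IsCsiszarTransformation φ) (v : Θ → ℝ) {a : ℝ≥0}
    {x : Θ → ℝ≥0} (h : perspective π φ a x ≠ ⊤) :
    ∑ θ, (π θ : ℝ) * (v θ * x θ) - a * ∑ θ, (π θ : ℝ) * psi φ (v θ)
      ≤ (perspective π φ a x).toReal :=
  (ENNReal.ofReal_le_iff_le_toReal h).1 (ofReal_le_perspective hφ v a x)

theorem separable_one (hφ : IsCsiszarTransformation φ) : separable π φ 1 = 0 := by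
  simp [separable, hφ.one]

theorem perspective_zero_zero (hφ : IsCsiszarTransformation φ) :
    perspective π φ 0 (0 : Θ → ℝ≥0) = 0 := by
  simp [perspective, recession, separable_one hφ]

theorem sum_mul_pos (hπ : IsPrior π) {x : Θ → ℝ≥0} (hx : x ≠ 0) : 0 < ∑ θ, π θ * x θ := by
  obtain ⟨i, hi⟩ := Function.ne_iff.1 hx
  exact Finset.sum_pos' (fun _ _ => zero_le)
    ⟨i, Finset.mem_univ _, mul_pos (hπ.2 i) (pos_iff_ne_zero.2 hi)⟩

/-- The linear bound with the constant dual vector `n` tends to `n ∑ π θ * x θ` as `a → 0`, and `n`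
is arbitrary. Taking `a = 0` shows that the recession value is infinite. -/
theorem eventually_lt_perspective (hφ : IsCsiszarTransformation φ) (hπ : IsPrior π)
    {x : Θ → ℝ≥0} (hx : x ≠ 0) (y : ℝ≥0) :
    ∀ᶠ a in 𝓝 (0 : ℝ≥0), (y : ℝ≥0∞) < perspective π φ a x := by
  have hpos : (0 : ℝ) < ∑ θ, (π θ : ℝ) * x θ := by exact_mod_cast sum_mul_pos hπ hx
  set w := ∑ θ, (π θ : ℝ) * x θ
  obtain ⟨n, hn⟩ := exists_gt ((y : ℝ) / w)
  have hlim : Tendsto (fun a : ℝ≥0 => n * w - a * ∑ θ, (π θ : ℝ) * psi φ n) (𝓝 0)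
      (𝓝 (n * w - ((0 : ℝ≥0) : ℝ) * ∑ θ, (π θ : ℝ) * psi φ n)) :=
    Continuous.tendsto (by fun_prop) 0
  have hlt : (y : ℝ) < n * w - ((0 : ℝ≥0) : ℝ) * ∑ θ, (π θ : ℝ) * psi φ n := by
    rw [div_lt_iff₀ hpos] at hn
    simpa using hn
  filter_upwards [hlim.eventually_const_lt hlt] with a ha
  refine lt_of_lt_of_le ?_ (ofReal_le_perspective hφ (fun _ => n) a x)
  rw [← ENNReal.ofReal_coe_nnreal, ENNReal.ofReal_lt_ofReal_iff_of_nonneg y.coe_nonneg]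
  refine ha.trans_le (le_of_eq ?_)
  congr 1
  rw [Finset.mul_sum]
  exact Finset.sum_congr rfl fun θ _ => by ring

theorem perspective_zero_of_ne (hφ : IsCsiszarTransformation φ) (hπ : IsPrior π)
    {x : Θ → ℝ≥0} (hx : x ≠ 0) : perspective π φ 0 x = ⊤ :=
  ENNReal.eq_top_of_forall_nnreal_le fun y =>
    ((eventually_lt_perspective hφ hπ hx y).self_of_nhds).le

theorem perspective_smul (hφ : IsCsiszarTransformation φ) (hπ : IsPrior π) {t : ℝ≥0} (ht : t ≠ 0)
    (a : ℝ≥0) (x : Θ → ℝ≥0) :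
    perspective π φ (t * a) (t • x) = t * perspective π φ a x := by
  rcases eq_or_ne a 0 with rfl | ha
  · rcases eq_or_ne x 0 with rfl | hx
    · simp [perspective_zero_zero hφ]
    · rw [mul_zero, perspective_zero_of_ne hφ hπ hx,
        perspective_zero_of_ne hφ hπ (smul_ne_zero ht hx), ENNReal.mul_top (by simpa using ht)]
  · rw [perspective_of_ne_zero ha, perspective_of_ne_zero (mul_ne_zero ht ha), ENNReal.coe_mul,
      mul_assoc]
    congr 3
    funext θ
    simp [mul_div_mul_left _ _ ht]

theorem lowerSemicontinuous_perspective (hφ : IsCsiszarTransformation φ) (hπ : IsPrior π)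
    (x : Θ → ℝ≥0) : LowerSemicontinuous fun a => perspective π φ a x := by
  intro a y hy
  rcases eq_or_ne a 0 with rfl | ha
  · rcases eq_or_ne x 0 with rfl | hx
    · simp [perspective_zero_zero hφ] at hy
    · lift y to ℝ≥0 using hy.ne_top
      exact eventually_lt_perspective hφ hπ hx y
  · have hlsc : LowerSemicontinuousAt (fun b : ℝ≥0 => separable π φ (fun θ => x θ / b)) a := by
      refine lowerSemicontinuousAt_sum fun θ _ => ?_
      have h1 : LowerSemicontinuousAt (fun b : ℝ≥0 => φ (x θ / b)) a :=
        LowerSemicontinuousAt.comp (hφ.lsc (x θ / a)) (continuousAt_const.div continuousAt_id ha)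
      exact (ENNReal.continuous_const_mul (by simp)).continuousAt.comp_lowerSemicontinuousAt h1
        (fun _ _ h => mul_le_mul_right h _)
    simp only [perspective_of_ne_zero ha] at hy
    have hlt : y / a < separable π φ (fun θ => x θ / a) := by
      rw [ENNReal.div_lt_iff (Or.inl (by simpa using ha)) (Or.inl (by simp)), mul_comm]
      exact hy
    obtain ⟨d, hd1, hd2⟩ := exists_between hlt
    rw [ENNReal.div_lt_iff (Or.inl (by simpa using ha)) (Or.inl (by simp))] at hd1
    have hcont : ContinuousAt (fun b : ℝ≥0 => d * (b : ℝ≥0∞)) a :=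
      ((ENNReal.continuous_const_mul hd2.ne_top).comp ENNReal.continuous_coe).continuousAt
    filter_upwards [hlsc d hd2, hcont.eventually_const_lt hd1, eventually_ne_nhds ha]
      with b hb1 hb2 hb3
    rw [perspective_of_ne_zero hb3]
    refine hb2.trans_le ?_
    rw [mul_comm]
    gcongr

/-- A reference distribution that minimizes the divergence exists. -/
theorem exists_fInformation_eq (hφ : IsCsiszarTransformation φ) (hπ : IsPrior π)
    {Ω : Type*} [Fintype Ω] [Nonempty Ω] (P : Experiment Θ Ω) :
    ∃ α : stdSimplex ℝ≥0 Ω, fInformation (separable π φ) P = fDivergence (separable π φ) P α := by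
  classical
  have hlsc : LowerSemicontinuous fun α : stdSimplex ℝ≥0 Ω => fDivergence (separable π φ) P α := by
    simp only [fDivergence_separable_eq]
    refine lowerSemicontinuous_sum fun ω _ => ?_
    exact LowerSemicontinuous.comp (f := fun a => perspective π φ a (fun θ => (P θ).1 ω))
      (lowerSemicontinuous_perspective hφ hπ _)
      (g := fun α : stdSimplex ℝ≥0 Ω => α.1 ω)
      ((continuous_apply ω).comp continuous_subtype_val)
  have : CompactSpace (stdSimplex ℝ≥0 Ω) := inferInstance
  obtain ⟨ω⟩ := ‹Nonempty Ω›
  obtain ⟨α, -, hα⟩ := LowerSemicontinuousOn.exists_isMinOn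
    (⟨⟨Pi.single ω 1, single_mem_stdSimplex _ ω⟩, mem_univ _⟩ :
      (univ : Set (stdSimplex ℝ≥0 Ω)).Nonempty) isCompact_univ (hlsc.lowerSemicontinuousOn _)
  exact ⟨α, le_antisymm (iInf_le _ _) (le_iInf fun β => hα (mem_univ β))⟩

theorem separable_ne_top_of_mem_Icc (hφ : IsCsiszarTransformation φ) {r s : ℝ≥0} (hr : φ r ≠ ⊤)
    (hs : φ s ≠ ⊤) {x : Θ → ℝ≥0} (hx : ∀ θ, x θ ∈ Icc r s) : separable π φ x ≠ ⊤ :=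
  ENNReal.sum_ne_top.2 fun θ _ => ENNReal.mul_ne_top (by simp)
    (hφ.ne_top_of_mem_Icc hr hs (hx θ).1 (hx θ).2)

theorem ne_top_of_separable_ne_top (hπ : IsPrior π) {x : Θ → ℝ≥0} (h : separable π φ x ≠ ⊤)
    (θ : Θ) : φ (x θ) ≠ ⊤ := by
  intro h'
  refine ENNReal.sum_ne_top.1 h θ (Finset.mem_univ θ) ?_
  rw [h', ENNReal.mul_top (by simpa using (hπ.2 θ).ne')]

/-- The point `2x / (a + b)` is the convex combination of `x / a` and `x / b` with weights
proportional to `a` and `b`. These points differ wherever `x θ ≠ 0`, so strict convexity of `φ`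
applies in that coordinate. -/
theorem perspective_add_lt (hφ : IsCsiszarTransformation φ) (hπ : IsPrior π) {a b : ℝ≥0}
    {x : Θ → ℝ≥0} (hx : x ≠ 0) (hab : a ≠ b) (ha : perspective π φ a x ≠ ⊤)
    (hb : perspective π φ b x ≠ ⊤) :
    perspective π φ (a + b) (2 • x) < perspective π φ a x + perspective π φ b x := by
  classical
  have ha0 : a ≠ 0 := by
    rintro rfl
    exact ha (perspective_zero_of_ne hφ hπ hx)
  have hb0 : b ≠ 0 := by
    rintro rfl
    exact hb (perspective_zero_of_ne hφ hπ hx)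
  have hab0 : a + b ≠ 0 := by simp [ha0]
  rw [perspective_of_ne_zero ha0] at ha ⊢
  rw [perspective_of_ne_zero hb0] at hb ⊢
  rw [perspective_of_ne_zero hab0]
  have ha' := ne_top_of_separable_ne_top hπ
    (fun h => ha (by rw [h, ENNReal.mul_top (by simpa using ha0)]))
  have hb' := ne_top_of_separable_ne_top hπ
    (fun h => hb (by rw [h, ENNReal.mul_top (by simpa using hb0)]))
  have hcomb : ∀ θ, (2 • x) θ / (a + b) =
      (a / (a + b)) • (x θ / a) + (b / (a + b)) • (x θ / b) := fun θ => by
    simp only [Pi.smul_apply, smul_eq_mul, nsmul_eq_mul]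
    field_simp
    push_cast
    ring
  have hone : a / (a + b) + b / (a + b) = 1 := by rw [← add_div, div_self hab0]
  have hsplit : ∀ θ, ((a + b : ℝ≥0) : ℝ≥0∞) *
      ((a / (a + b)) • φ (x θ / a) + (b / (a + b)) • φ (x θ / b)) =
        a * φ (x θ / a) + b * φ (x θ / b) := fun θ => by
    simp only [ENNReal.smul_def, smul_eq_mul]
    rw [mul_add, ← mul_assoc, ← mul_assoc, ← ENNReal.coe_mul, ← ENNReal.coe_mul,
      mul_div_cancel₀ _ hab0, mul_div_cancel₀ _ hab0]
  have hle : ∀ θ, ((a + b : ℝ≥0) : ℝ≥0∞) * φ ((2 • x) θ / (a + b)) ≤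
      a * φ (x θ / a) + b * φ (x θ / b) := fun θ => by
    rw [← hsplit, hcomb]
    gcongr
    exact hφ.strictConvex.convexOn.2 (ha' θ) (hb' θ) zero_le zero_le hone
  obtain ⟨i, hi⟩ := Function.ne_iff.1 hx
  have hlt : ((a + b : ℝ≥0) : ℝ≥0∞) * φ ((2 • x) i / (a + b)) <
      a * φ (x i / a) + b * φ (x i / b) := by
    rw [← hsplit, hcomb]
    refine ENNReal.mul_lt_mul_right (by simpa using hab0) (by simp) ?_
    refine hφ.strictConvex.2 (ha' i) (hb' i) (fun h => hab ?_) (by positivity) (by positivity) hone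
    have hi' : x i ≠ 0 := hi
    field_simp at h
    exact h.symm
  have key : ∀ y : Θ → ℝ≥0, ∀ c : ℝ≥0, (c : ℝ≥0∞) * separable π φ y =
      ∑ θ, (π θ : ℝ≥0∞) * (c * φ (y θ)) := fun y c => by
    rw [separable, Finset.mul_sum]
    exact Finset.sum_congr rfl fun θ _ => by ring
  rw [key, key, key, ← Finset.sum_add_distrib]
  simp only [← mul_add]
  rw [← Finset.add_sum_erase _ _ (Finset.mem_univ i), ← Finset.add_sum_erase _ _ (Finset.mem_univ i)]
  refine ENNReal.add_lt_add_of_lt_of_le ?_ ?_ ?_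
  · refine (ENNReal.sum_lt_top.2 fun θ _ => ?_).ne
    exact lt_of_le_of_lt (mul_le_mul_right (hle θ) _) (ENNReal.mul_lt_top (by simp)
      (ENNReal.add_lt_top.2 ⟨ENNReal.mul_lt_top (by simp) (ha' θ).lt_top,
        ENNReal.mul_lt_top (by simp) (hb' θ).lt_top⟩))
  · exact ENNReal.mul_lt_mul_right (by simpa using (hπ.2 i).ne') (by simp) hlt
  · exact Finset.sum_le_sum fun θ _ => mul_le_mul_right (hle θ) _

end Perspective

/-! ### Mixing experiments and the common Lagrange multiplier -/

section Mixture

/-- The mixture of two distributions on disjoint outcome spaces. -/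
noncomputable def mixSimplex {Ω Ω' : Type*} [Fintype Ω] [Fintype Ω'] {a b : ℝ≥0} (hab : a + b = 1)
    (p : stdSimplex ℝ≥0 Ω) (q : stdSimplex ℝ≥0 Ω') : stdSimplex ℝ≥0 (Ω ⊕ Ω') :=
  ⟨Sum.elim (a • p.1) (b • q.1), fun _ => zero_le, by
    have hp : ∑ ω, p.1 ω = 1 := p.2.2
    have hq : ∑ ω, q.1 ω = 1 := q.2.2
    simp [← Finset.mul_sum, hp, hq, hab]⟩

variable {Θ : Type*} [Fintype Θ] {π : Θ → ℝ≥0} {φ : ℝ≥0 → ℝ≥0∞}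

/-- The cost is a sum over outcomes of a positively homogeneous function of the likelihoods. -/
def IsOutcomeAdditive (C : CostFunction Θ) : Prop :=
  ∃ G : (Θ → ℝ≥0) → ℝ≥0∞, (∀ t : ℝ≥0, t ≠ 0 → ∀ x, G (t • x) = t * G x) ∧
    ∀ (Ω : Type) [Fintype Ω] (P : Experiment Θ Ω), C Ω P = ∑ ω, G fun θ => (P θ).1 ω

/-- The weight `P_π(ω)` and the posterior depend only on the likelihoods at `ω`, and are homogeneous
of degree one and zero. The forward direction uses posterior separability only through this
consequence. -/
theorem IsPosteriorSeparable.isOutcomeAdditive {C : CostFunction Θ}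
    (h : IsPosteriorSeparable π C) : IsOutcomeAdditive C := by
  classical
  obtain ⟨H, -, hC⟩ := h
  refine ⟨fun x => if ∑ θ, π θ * x θ = 0 then 0 else
    ((∑ θ, π θ * x θ : ℝ≥0) : ℝ≥0∞) * H (fun θ => x θ * π θ / ∑ θ, π θ * x θ), ?_, ?_⟩
  · intro t ht x
    have e : ∑ θ, π θ * (t • x) θ = t * ∑ θ, π θ * x θ := by
      rw [Finset.mul_sum]
      exact Finset.sum_congr rfl fun θ _ => by simp only [Pi.smul_apply, smul_eq_mul]; ring
    simp only [e, mul_eq_zero, ht, false_or]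
    split_ifs
    · simp
    · rw [ENNReal.coe_mul, mul_assoc]
      congr 3
      funext θ
      simp only [Pi.smul_apply, smul_eq_mul]
      rw [mul_assoc, mul_div_mul_left _ _ ht]
  · intro Ω _ P
    rw [hC, posteriorSeparableCost, Finset.sum_filter]
    refine Finset.sum_congr rfl fun ω _ => ?_
    change (if ¬ unconditional π P ω = 0 then _ else _) = if unconditional π P ω = 0 then _ else _
    rw [ite_not]
    rfl

/-- An experiment of finite cost together with a minimizing reference distribution. -/
def IsOptimal {Ω : Type} [Fintype Ω] (π : Θ → ℝ≥0) (φ : ℝ≥0 → ℝ≥0∞) (P : Experiment Θ Ω)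
    (α : stdSimplex ℝ≥0 Ω) : Prop :=
  fDivergence (separable π φ) P α ≠ ⊤ ∧ ∀ β, fDivergence (separable π φ) P α ≤
    fDivergence (separable π φ) P β

theorem IsOptimal.csiszarCost_eq {Ω : Type} [Fintype Ω] {P : Experiment Θ Ω}
    {α : stdSimplex ℝ≥0 Ω} (h : IsOptimal π φ P α) :
    csiszarCost π φ Ω P = fDivergence (separable π φ) P α :=
  le_antisymm (iInf_le _ _) (le_iInf h.2)

theorem exists_isOptimal (hφ : IsCsiszarTransformation φ) (hπ : IsPrior π) {Ω : Type} [Fintype Ω]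
    {P : Experiment Θ Ω} {β : stdSimplex ℝ≥0 Ω} (h : fDivergence (separable π φ) P β ≠ ⊤) :
    ∃ α, IsOptimal π φ P α := by
  have : Nonempty Ω := by
    by_contra hΩ
    rw [not_nonempty_iff] at hΩ
    simpa using β.2.2
  obtain ⟨α, hα⟩ := exists_fInformation_eq hφ hπ P
  have hle : ∀ β, fDivergence (separable π φ) P α ≤ fDivergence (separable π φ) P β :=
    fun β => hα ▸ iInf_le _ β
  exact ⟨α, ne_top_of_le_ne_top h (hle β), hle⟩

theorem fDivergence_mix (hφ : IsCsiszarTransformation φ) (hπ : IsPrior π) {Ω Ω' : Type}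
    [Fintype Ω] [Fintype Ω'] {a b : ℝ≥0} (hab : a + b = 1) (ha : a ≠ 0) (hb : b ≠ 0)
    (P : Experiment Θ Ω) (Q : Experiment Θ Ω') (α : stdSimplex ℝ≥0 Ω) (β : stdSimplex ℝ≥0 Ω') :
    fDivergence (separable π φ) (fun θ => mixSimplex hab (P θ) (Q θ)) (mixSimplex hab α β) =
      a * fDivergence (separable π φ) P α + b * fDivergence (separable π φ) Q β := by
  simp only [fDivergence_separable_eq, Fintype.sum_sum_type, mixSimplex, Sum.elim_inl,
    Sum.elim_inr, Finset.mul_sum]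
  congr 1
  · exact Finset.sum_congr rfl fun ω _ => perspective_smul hφ hπ ha _ _
  · exact Finset.sum_congr rfl fun ω _ => perspective_smul hφ hπ hb _ _

/-- Both the cost and the divergence average under mixing, so the mixed reference attains the cost
of the mixed experiment. -/
theorem IsOptimal.mix (hφ : IsCsiszarTransformation φ) (hπ : IsPrior π)
    (hC : IsOutcomeAdditive (csiszarCost π φ)) {Ω Ω' : Type}
    [Fintype Ω] [Fintype Ω'] {a b : ℝ≥0} (hab : a + b = 1) (ha : a ≠ 0) (hb : b ≠ 0)
    {P : Experiment Θ Ω} {Q : Experiment Θ Ω'} {α : stdSimplex ℝ≥0 Ω} {β : stdSimplex ℝ≥0 Ω'}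
    (hP : IsOptimal π φ P α) (hQ : IsOptimal π φ Q β) :
    IsOptimal π φ (fun θ => mixSimplex hab (P θ) (Q θ)) (mixSimplex hab α β) := by
  obtain ⟨G, hG, hCG⟩ := hC
  have hcost : csiszarCost π φ (Ω ⊕ Ω') (fun θ => mixSimplex hab (P θ) (Q θ)) =
      a * csiszarCost π φ Ω P + b * csiszarCost π φ Ω' Q := by
    simp only [hCG, Fintype.sum_sum_type, mixSimplex, Sum.elim_inl, Sum.elim_inr, Finset.mul_sum]
    congr 1
    · exact Finset.sum_congr rfl fun ω _ => hG a ha _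
    · exact Finset.sum_congr rfl fun ω _ => hG b hb _
  rw [hP.csiszarCost_eq, hQ.csiszarCost_eq, ← fDivergence_mix hφ hπ hab ha hb] at hcost
  constructor
  · rw [fDivergence_mix hφ hπ hab ha hb]
    exact ENNReal.add_ne_top.2 ⟨ENNReal.mul_ne_top (by simp) hP.1, ENNReal.mul_ne_top (by simp) hQ.1⟩
  · intro γ
    rw [← hcost]
    exact iInf_le _ γ

theorem IsOptimal.perspective_ne_top {Ω : Type} [Fintype Ω] {P : Experiment Θ Ω}
    {α : stdSimplex ℝ≥0 Ω} (h : IsOptimal π φ P α) (ω : Ω) :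
    perspective π φ (α.1 ω) (fun θ => (P θ).1 ω) ≠ ⊤ :=
  ENNReal.sum_ne_top.1 h.1 ω (Finset.mem_univ ω)

/-- Moving reference mass between two outcomes does not decrease the divergence. -/
theorem IsOptimal.le_of_shift {Ω : Type} [Fintype Ω] {P : Experiment Θ Ω}
    {α : stdSimplex ℝ≥0 Ω} (h : IsOptimal π φ P α) {i j : Ω} (hij : i ≠ j) {s : ℝ≥0}
    (hs : s ≤ α.1 j) :
    perspective π φ (α.1 i) (fun θ => (P θ).1 i) + perspective π φ (α.1 j) (fun θ => (P θ).1 j) ≤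
      perspective π φ (α.1 i + s) (fun θ => (P θ).1 i) +
        perspective π φ (α.1 j - s) (fun θ => (P θ).1 j) := by
  classical
  have hj : j ∈ Finset.univ.erase i := by simp [hij.symm]
  have hsplit : ∀ f : Ω → ℝ≥0∞, ∑ ω, f ω = (f i + f j) + ∑ ω ∈ (Finset.univ.erase i).erase j, f ω :=
    fun f => by
      rw [← Finset.add_sum_erase _ _ (Finset.mem_univ i), ← Finset.add_sum_erase _ _ hj, add_assoc]
  have hsplit' : ∀ f : Ω → ℝ≥0, ∑ ω, f ω = (f i + f j) + ∑ ω ∈ (Finset.univ.erase i).erase j, f ω :=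
    fun f => by
      rw [← Finset.add_sum_erase _ _ (Finset.mem_univ i), ← Finset.add_sum_erase _ _ hj, add_assoc]
  let g : Ω → ℝ≥0 := fun ω => if ω = i then α.1 i + s else if ω = j then α.1 j - s else α.1 ω
  have hgi : g i = α.1 i + s := by simp [g]
  have hgj : g j = α.1 j - s := by simp [g, hij.symm]
  have hg : ∀ ω ∈ (Finset.univ.erase i).erase j, g ω = α.1 ω := fun ω hω => by
    simp only [Finset.mem_erase] at hω
    simp [g, hω.1, hω.2.1]
  have hg1 : ∑ ω, g ω = 1 := by
    rw [← α.2.2, hsplit' g, hsplit' α.1, hgi, hgj, Finset.sum_congr rfl hg, add_assoc (α.1 i),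
      add_tsub_cancel_of_le hs]
  have hle := h.2 ⟨g, fun _ => zero_le, hg1⟩
  have hfin := h.1
  simp only [fDivergence_separable_eq] at hle hfin
  have hrest : ∑ ω ∈ (Finset.univ.erase i).erase j, perspective π φ (g ω) (fun θ => (P θ).1 ω) =
      ∑ ω ∈ (Finset.univ.erase i).erase j, perspective π φ (α.1 ω) (fun θ => (P θ).1 ω) :=
    Finset.sum_congr rfl fun ω hω => by rw [hg ω hω]
  rw [hsplit, hsplit (fun ω => perspective π φ (g ω) _), hgi, hgj, hrest] at hle
  rw [hsplit] at hfin
  exact (ENNReal.add_le_add_iff_right (ENNReal.add_ne_top.1 hfin).2).1 hle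

/-- The vector `x` of likelihoods of an outcome and its optimal reference probability `a`. -/
def IsOptimalPair (π : Θ → ℝ≥0) (φ : ℝ≥0 → ℝ≥0∞) (x : Θ → ℝ≥0) (a : ℝ≥0) : Prop :=
  ∃ (Ω : Type) (_ : Fintype Ω) (P : Experiment Θ Ω) (α : stdSimplex ℝ≥0 Ω) (ω : Ω),
    IsOptimal π φ P α ∧ (fun θ => (P θ).1 ω) = x ∧ α.1 ω = a

theorem IsOptimalPair.ne_top {x : Θ → ℝ≥0} {a : ℝ≥0} (h : IsOptimalPair π φ x a) :
    perspective π φ a x ≠ ⊤ := by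
  obtain ⟨Ω, _, P, α, ω, hα, rfl, rfl⟩ := h
  exact hα.perspective_ne_top ω

theorem isOptimalPair_one (hφ : IsCsiszarTransformation φ) : IsOptimalPair π φ 1 1 := by
  have h0 : ∀ α : stdSimplex ℝ≥0 Unit, α.1 () = 1 := fun α => by simpa using α.2.2
  let α : stdSimplex ℝ≥0 Unit := ⟨1, fun _ => zero_le, by simp⟩
  have hD : fDivergence (separable π φ) (fun _ : Θ => α) α = 0 := by
    have : separable π φ (fun _ => 1) = 0 := separable_one hφ
    simp [fDivergence_separable_eq, h0, perspective_one, this]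
  exact ⟨Unit, inferInstance, fun _ => α, α, (), ⟨by simp [hD], by simp [hD]⟩, rfl, rfl⟩

/-- Mix the two experiments with weights `w / (u + w)` and `u / (u + w)`. Moving mass `u w / (u +
w)` between the two outcomes then shifts the unscaled masses by exactly `u` and `w`. -/
theorem IsOptimalPair.le_of_shift (hφ : IsCsiszarTransformation φ) (hπ : IsPrior π)
    (hC : IsOutcomeAdditive (csiszarCost π φ)) {x y : Θ → ℝ≥0} {a b u w : ℝ≥0}
    (hx : IsOptimalPair π φ x a) (hy : IsOptimalPair π φ y b) (hu : 0 < u) (hw : 0 < w)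
    (hwb : w ≤ b) :
    w * perspective π φ a x + u * perspective π φ b y ≤
      w * perspective π φ (a + u) x + u * perspective π φ (b - w) y := by
  obtain ⟨Ω, _, P, α, ω, hα, rfl, rfl⟩ := hx
  obtain ⟨Ω', _, Q, β, ω', hβ, rfl, rfl⟩ := hy
  have huw : u + w ≠ 0 := (add_pos hu hw).ne'
  have hab : w / (u + w) + u / (u + w) = 1 := by rw [← add_div, add_comm, div_self huw]
  have hp : w / (u + w) ≠ 0 := (div_pos hw (add_pos hu hw)).ne'
  have hq : u / (u + w) ≠ 0 := (div_pos hu (add_pos hu hw)).ne'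
  have hshift := (hα.mix hφ hπ hC hab hp hq hβ).le_of_shift (i := Sum.inl ω) (j := Sum.inr ω')
    (by simp) (s := w / (u + w) * u) (by
      change w / (u + w) * u ≤ u / (u + w) * β.1 ω'
      rw [div_mul_eq_mul_div, div_mul_eq_mul_div, mul_comm w u]
      gcongr)
  have e1 : (mixSimplex hab α β).1 (Sum.inl ω) + w / (u + w) * u = w / (u + w) * (α.1 ω + u) := by
    rw [mul_add]; rfl
  have e2 : (mixSimplex hab α β).1 (Sum.inr ω') - w / (u + w) * u =
      u / (u + w) * (β.1 ω' - w) := by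
    rw [mul_tsub, div_mul_eq_mul_div, div_mul_eq_mul_div, div_mul_eq_mul_div, mul_comm w u]
    change u / (u + w) * β.1 ω' - _ = _
    rw [div_mul_eq_mul_div]
  rw [e1, e2] at hshift
  have key : ∀ c d : ℝ≥0,
      (perspective π φ (w / (u + w) * c) fun θ => (mixSimplex hab (P θ) (Q θ)).1 (Sum.inl ω)) +
      (perspective π φ (u / (u + w) * d) fun θ => (mixSimplex hab (P θ) (Q θ)).1 (Sum.inr ω')) =
      (w * perspective π φ c (fun θ => (P θ).1 ω) + u * perspective π φ d (fun θ => (Q θ).1 ω')) /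
        ((u + w : ℝ≥0) : ℝ≥0∞) := fun c d => by
    have h1 := perspective_smul hφ hπ hp c (fun θ => (P θ).1 ω)
    have h2 := perspective_smul hφ hπ hq d (fun θ => (Q θ).1 ω')
    change perspective π φ (w / (u + w) * c) ((w / (u + w)) • fun θ => (P θ).1 ω) +
      perspective π φ (u / (u + w) * d) ((u / (u + w)) • fun θ => (Q θ).1 ω') = _
    rw [h1, h2, ENNReal.coe_div huw, ENNReal.coe_div huw, ENNReal.add_div]
    simp only [ENNReal.div_eq_inv_mul, mul_assoc]
  have h := hshift
  change perspective π φ (w / (u + w) * α.1 ω) _ + perspective π φ (u / (u + w) * β.1 ω') _ ≤ _ at h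
  rw [key, key] at h
  rwa [ENNReal.div_le_iff_le_mul (Or.inl (by simpa using huw)) (Or.inl (by simp)),
    ENNReal.div_mul_cancel (by simpa using huw) (by simp)] at h

/-- The number `a` minimizes the contribution `a ↦ a f(x / a) + l a` of an outcome to the
Lagrangian. -/
def IsTiltedMin (π : Θ → ℝ≥0) (φ : ℝ≥0 → ℝ≥0∞) (l : ℝ) (x : Θ → ℝ≥0) (a : ℝ≥0) : Prop :=
  perspective π φ a x ≠ ⊤ ∧ ∀ b, perspective π φ b x ≠ ⊤ →
    (perspective π φ a x).toReal + l * a ≤ (perspective π φ b x).toReal + l * b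

/-- Provides finite difference quotients on both sides of the uninformative pair `(1, 1)`, so that
the supremum defining the multiplier is over a nonempty bounded set. -/
theorem exists_perspective_const_ne_top (hφ : IsCsiszarTransformation φ)
    (hnd : ∃ t : ℝ≥0, t ≠ 1 ∧ φ t ≠ ⊤) :
    (∃ a : ℝ≥0, 1 < a ∧ perspective π φ a 1 ≠ ⊤) ∧
      ∃ a : ℝ≥0, 0 < a ∧ a < 1 ∧ perspective π φ a 1 ≠ ⊤ := by
  obtain ⟨r, s, hr, hs, hr', hs'⟩ := hφ.exists_lt_one_lt hnd
  have h1 : φ 1 ≠ ⊤ := by simp [hφ.one]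
  have key : ∀ a : ℝ≥0, a ≠ 0 → φ a⁻¹ ≠ ⊤ → perspective π φ a 1 ≠ ⊤ := fun a ha h => by
    rw [perspective_of_ne_zero ha]
    refine ENNReal.mul_ne_top (by simp) (ENNReal.sum_ne_top.2 fun θ _ => ENNReal.mul_ne_top (by simp) ?_)
    simpa using h
  constructor
  · obtain ⟨q, hq, hq1⟩ := exists_between hr
    have hq0 : 0 < q := zero_le.trans_lt hq
    exact ⟨q⁻¹, (one_lt_inv₀ hq0).2 hq1, key _ (inv_pos.2 hq0).ne'
      (by rw [inv_inv]; exact hφ.ne_top_of_mem_Icc hr' h1 hq.le hq1.le)⟩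
  · have hs0 : 0 < s := zero_lt_one.trans hs
    exact ⟨s⁻¹, inv_pos.2 hs0, inv_lt_one_of_one_lt₀ hs, key _ (inv_pos.2 hs0).ne'
      (by rwa [inv_inv])⟩

/-- A common Lagrange multiplier for all experiments of finite cost. -/
theorem exists_isTiltedMin (hφ : IsCsiszarTransformation φ) (hπ : IsPrior π)
    (hnd : ∃ t : ℝ≥0, t ≠ 1 ∧ φ t ≠ ⊤) (hC : IsOutcomeAdditive (csiszarCost π φ)) :
    ∃ l : ℝ, ∀ x a, IsOptimalPair π φ x a → IsTiltedMin π φ l x a := by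
  -- `S` collects the left difference quotients at optimal pairs. By `hS` each lies below every
  -- right difference quotient, even of another pair, so `sSup S` separates them and its negative is
  -- the multiplier.
  let S : Set ℝ := {r | ∃ (y : Θ → ℝ≥0) (b w : ℝ≥0), IsOptimalPair π φ y b ∧ 0 < w ∧ w ≤ b ∧
    perspective π φ (b - w) y ≠ ⊤ ∧
    r = ((perspective π φ b y).toReal - (perspective π φ (b - w) y).toReal) / w}
  have hS : ∀ x a u, IsOptimalPair π φ x a → 0 < u → perspective π φ (a + u) x ≠ ⊤ → ∀ r ∈ S,
      r ≤ ((perspective π φ (a + u) x).toReal - (perspective π φ a x).toReal) / u := by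
    rintro x a u hx hu hfin r ⟨y, b, w, hy, hw, hwb, hfin', rfl⟩
    have h := ENNReal.toReal_mono (ENNReal.add_ne_top.2 ⟨ENNReal.mul_ne_top (by simp) hfin,
      ENNReal.mul_ne_top (by simp) hfin'⟩) (hx.le_of_shift hφ hπ hC hy hu hw hwb)
    rw [ENNReal.toReal_add (ENNReal.mul_ne_top (by simp) hx.ne_top)
      (ENNReal.mul_ne_top (by simp) hy.ne_top), ENNReal.toReal_add
      (ENNReal.mul_ne_top (by simp) hfin) (ENNReal.mul_ne_top (by simp) hfin')] at h
    simp only [ENNReal.toReal_mul, ENNReal.coe_toReal] at h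
    have hu' : (0 : ℝ) < u := by exact_mod_cast hu
    have hw' : (0 : ℝ) < w := by exact_mod_cast hw
    rw [div_le_div_iff₀ hw' hu']
    linarith
  have h1 : IsOptimalPair π φ 1 1 := isOptimalPair_one hφ
  obtain ⟨⟨p, hp1, hp⟩, q, hq0, hq1, hq⟩ := exists_perspective_const_ne_top (π := π) hφ hnd
  have hne : S.Nonempty := ⟨_, 1, 1, 1 - q, h1, tsub_pos_of_lt hq1, tsub_le_self, by
    rwa [tsub_tsub_cancel_of_le hq1.le], rfl⟩
  have hbdd : BddAbove S := ⟨_, fun r hr => hS 1 1 (p - 1) h1 (tsub_pos_of_lt hp1) (by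
    rwa [add_tsub_cancel_of_le hp1.le]) r hr⟩
  refine ⟨-sSup S, fun x a hx => ⟨hx.ne_top, fun b hb => ?_⟩⟩
  rcases lt_trichotomy a b with hab | rfl | hab
  · have h := csSup_le hne (hS x a (b - a) hx (tsub_pos_of_lt hab) (by
      rwa [add_tsub_cancel_of_le hab.le]))
    have hab' : (a : ℝ) < b := by exact_mod_cast hab
    rw [add_tsub_cancel_of_le hab.le, NNReal.coe_sub hab.le, le_div_iff₀ (by linarith)] at h
    linarith
  · exact le_rfl
  · have h := le_csSup hbdd (⟨x, a, a - b, hx, tsub_pos_of_lt hab, tsub_le_self, by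
      rwa [tsub_tsub_cancel_of_le hab.le], rfl⟩ : _ ∈ S)
    have hab' : (b : ℝ) < a := by exact_mod_cast hab
    rw [tsub_tsub_cancel_of_le hab.le, NNReal.coe_sub hab.le, div_le_iff₀ (by linarith)] at h
    linarith

end Mixture

/-! ### Uniqueness, additivity and linearity of the optimal reference mass -/

section TiltedMin

variable {Θ : Type*} [Fintype Θ] {π : Θ → ℝ≥0} {φ : ℝ≥0 → ℝ≥0∞} {l : ℝ}

theorem IsTiltedMin.unique (hφ : IsCsiszarTransformation φ) (hπ : IsPrior π) {x : Θ → ℝ≥0}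
    (hx : x ≠ 0) {a b : ℝ≥0} (ha : IsTiltedMin π φ l x a) (hb : IsTiltedMin π φ l x b) :
    a = b := by
  by_contra hab
  have hlt := perspective_add_lt hφ hπ hx hab ha.1 hb.1
  have e1 : a + b = 2 * ((a + b) / 2) := by field_simp
  have e2 : (2 • x : Θ → ℝ≥0) = (2 : ℝ≥0) • x := by
    funext θ
    simp
  rw [e1, e2, perspective_smul hφ hπ two_ne_zero] at hlt
  have hmid : perspective π φ ((a + b) / 2) x ≠ ⊤ := by
    intro h
    rw [h, ENNReal.mul_top (by simp)] at hlt
    exact not_top_lt hlt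
  have h1 := ha.2 _ hmid
  have h2 := hb.2 _ hmid
  have h3 := (ENNReal.toReal_lt_toReal hlt.ne_top (ENNReal.add_ne_top.2 ⟨ha.1, hb.1⟩)).2 hlt
  rw [ENNReal.toReal_add ha.1 hb.1, ENNReal.toReal_mul] at h3
  push_cast at h1 h2 h3
  simp only [ENNReal.toReal_ofNat] at h3
  linarith

theorem IsTiltedMin.smul (hφ : IsCsiszarTransformation φ) (hπ : IsPrior π) {x : Θ → ℝ≥0}
    {a : ℝ≥0} (ha : IsTiltedMin π φ l x a) {t : ℝ≥0} (ht : t ≠ 0) :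
    IsTiltedMin π φ l (t • x) (t * a) := by
  refine ⟨?_, fun b hb => ?_⟩
  · rw [perspective_smul hφ hπ ht]
    exact ENNReal.mul_ne_top (by simp) ha.1
  · have e : b = t * (b / t) := by field_simp
    rw [e, perspective_smul hφ hπ ht] at hb
    have h := ha.2 (b / t) (fun h => hb (by rw [h, ENNReal.mul_top (by simpa using ht)]))
    rw [e, perspective_smul hφ hπ ht, perspective_smul hφ hπ ht, ENNReal.toReal_mul,
      ENNReal.toReal_mul, ENNReal.coe_toReal]
    have ht' : (0 : ℝ) ≤ t := t.coe_nonneg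
    have := mul_le_mul_of_nonneg_left h ht'
    push_cast at this ⊢
    linarith

/-- Likelihoods that are dual to `v` on the level set `∑ θ, π θ * ψ (v θ) = l` have optimal
reference probability one. -/
theorem isTiltedMin_of_deriv (hφ : IsCsiszarTransformation φ) (hd : Differentiable ℝ (psi φ))
    {v : Θ → ℝ} (hv : ∑ θ, (π θ : ℝ) * psi φ (v θ) = l) {x : Θ → ℝ≥0}
    (hx : ∀ θ, deriv (psi φ) (v θ) = x θ) : IsTiltedMin π φ l x 1 := by
  have hdual : ∀ θ, φ (x θ) ≠ ⊤ ∧ v θ * x θ = (φ (x θ)).toReal + psi φ (v θ) := fun θ => by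
    obtain ⟨s, hs, h⟩ := hφ.exists_deriv hd (v θ)
    have : s = x θ := NNReal.coe_injective (hs.symm.trans (hx θ))
    exact this ▸ h
  have hval : (perspective π φ 1 x).toReal = ∑ θ, (π θ : ℝ) * (φ (x θ)).toReal := by
    rw [perspective_one, separable, ENNReal.toReal_sum fun θ _ =>
      ENNReal.mul_ne_top (by simp) (hdual θ).1]
    simp
  refine ⟨?_, fun b hb => ?_⟩
  · rw [perspective_one]
    exact ENNReal.sum_ne_top.2 fun θ _ => ENNReal.mul_ne_top (by simp) (hdual θ).1
  · have h := le_toReal_perspective hφ v hb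
    rw [hv] at h
    simp only [fun θ => (hdual θ).2, mul_add, Finset.sum_add_distrib, hv] at h
    rw [hval]
    push_cast
    linarith

/-- For the constant likelihood `1`, mass `1 / s` contributes `φ s / s`. Minimality at mass one thus
says that the line of slope `l` through `(1, 0)` supports `φ`. -/
theorem IsTiltedMin.psi_eq (hφ : IsCsiszarTransformation φ) (hπ : IsPrior π)
    (h1 : IsTiltedMin π φ l 1 1) : psi φ l = l := by
  have hval : ∀ a : ℝ≥0, a ≠ 0 → perspective π φ a 1 = a * φ a⁻¹ := fun a ha => by
    rw [perspective_of_ne_zero ha, separable]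
    simp only [Pi.one_apply, one_div]
    rw [← Finset.sum_mul, ← ENNReal.ofNNReal_finsetSum, hπ.1.2, ENNReal.coe_one, one_mul]
  have hpos : ∀ s : ℝ≥0, s ≠ 0 → φ s ≠ ⊤ → l * (s - 1) ≤ (φ s).toReal := fun s hs hs' => by
    have e := hval s⁻¹ (inv_ne_zero hs)
    rw [inv_inv] at e
    have h := h1.2 s⁻¹ (by rw [e]; exact ENNReal.mul_ne_top (by simp) hs')
    rw [e, hval 1 one_ne_zero] at h
    simp only [ENNReal.toReal_mul, inv_one, hφ.one, mul_zero, ENNReal.toReal_zero, NNReal.coe_one, zero_add, mul_one,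
      ENNReal.coe_toReal, NNReal.coe_inv] at h
    have hs0 : (0 : ℝ) < s := by exact_mod_cast pos_iff_ne_zero.2 hs
    have := mul_le_mul_of_nonneg_left h hs0.le
    field_simp at this
    linarith
  refine hφ.psi_eq_self fun s hs => ?_
  rcases eq_or_ne s 0 with rfl | hs0
  -- No mass `a` has `1 / a = 0`, so the bound at `0` is deduced from the one at `1 / 2` through `φ
  -- (1 / 2) ≤ φ 0 / 2`.
  · have hle := hφ.strictConvex.convexOn.2 (show (0 : ℝ≥0) ∈ {t | φ t ≠ ⊤} from hs)
      (show (1 : ℝ≥0) ∈ {t | φ t ≠ ⊤} by simp [hφ.one])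
      (zero_le : (0 : ℝ≥0) ≤ 2⁻¹) (zero_le : (0 : ℝ≥0) ≤ 2⁻¹) (by rw [← NNReal.coe_inj]; norm_num)
    simp only [smul_eq_mul, mul_zero, zero_add, mul_one, hφ.one, add_zero, ENNReal.smul_def] at hle
    have hfin : ((2⁻¹ : ℝ≥0) : ℝ≥0∞) * φ 0 ≠ ⊤ := ENNReal.mul_ne_top (by simp) hs
    have h2 := hpos 2⁻¹ (by simp) (ne_top_of_le_ne_top hfin hle)
    have h3 := ENNReal.toReal_mono hfin hle
    rw [ENNReal.toReal_mul, ENNReal.coe_toReal] at h3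
    push_cast at h2 h3 ⊢
    linarith
  · exact hpos s hs0 hs

/-- Outcomes of finite cost can be completed, after scaling, to an experiment of finite cost. -/
theorem eventually_exists_completion (hφ : IsCsiszarTransformation φ) (hπ : IsPrior π)
    (hnd : ∃ t : ℝ≥0, t ≠ 1 ∧ φ t ≠ ⊤) (hl : ∀ x a, IsOptimalPair π φ x a → IsTiltedMin π φ l x a)
    {ι : Type} [Fintype ι] {x : ι → Θ → ℝ≥0} {a : ι → ℝ≥0}
    (hx : ∀ i, perspective π φ (a i) (x i) ≠ ⊤) :
    ∀ᶠ ε in 𝓝[>] (0 : ℝ≥0), ∃ (α : ι → ℝ≥0) (z : ℝ≥0), ∑ i, α i + z = 1 ∧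
      (∀ i, IsTiltedMin π φ l (ε • x i) (α i)) ∧
      IsTiltedMin π φ l (fun θ => 1 - ε * (∑ i, x i) θ) z ∧
      (fun θ => 1 - ε * (∑ i, x i) θ) ≠ 0 := by
  obtain ⟨r, s, hr, hs, hr', hs'⟩ := hφ.exists_lt_one_lt hnd
  have hΘ : Nonempty Θ := by
    by_contra h
    rw [not_nonempty_iff] at h
    simpa using hπ.1.2
  have hlt : ∀ c : ℝ≥0, ∀ᶠ ε in 𝓝[>] (0 : ℝ≥0), ε * c < 1 := fun c => by
    have : Tendsto (fun ε : ℝ≥0 => ε * c) (𝓝 0) (𝓝 (0 * c)) := Continuous.tendsto (by fun_prop) 0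
    exact (this.mono_left nhdsWithin_le_nhds).eventually_lt_const (by simp)
  -- The residual outcome has likelihood-to-reference ratios tending to `1` as `ε → 0`, hence inside
  -- the interval `[r, s]` on which `φ` is finite.
  have hratio : ∀ θ, ∀ᶠ ε in 𝓝[>] (0 : ℝ≥0),
      (1 - ε * (∑ i, x i) θ) / (1 - ε * ∑ i, a i) ∈ Icc r s := fun θ => by
    have : ContinuousAt (fun ε : ℝ≥0 => (1 - ε * (∑ i, x i) θ) / (1 - ε * ∑ i, a i)) 0 :=
      ContinuousAt.div (by fun_prop) (by fun_prop) (by simp)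
    refine (this.tendsto.mono_left nhdsWithin_le_nhds).eventually (Icc_mem_nhds ?_ ?_)
    · simpa using hr
    · simpa using hs
  filter_upwards [hlt (∑ i, a i), eventually_all.2 fun θ => hlt ((∑ i, x i) θ),
    eventually_all.2 hratio, self_mem_nhdsWithin] with ε h1 h2 h3 h4
  have hε : ε ≠ 0 := (mem_Ioi.1 h4).ne'
  let P : Experiment Θ (Option ι) := fun θ =>
    ⟨fun o => o.elim (1 - ε * (∑ i, x i) θ) fun i => ε * x i θ, fun _ => zero_le, by
      rw [Fintype.sum_option]
      simp only [Option.elim_none, Option.elim_some, ← Finset.mul_sum, Finset.sum_apply]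
      have := (h2 θ).le
      rw [Finset.sum_apply] at this
      exact tsub_add_cancel_of_le this⟩
  let β : stdSimplex ℝ≥0 (Option ι) :=
    ⟨fun o => o.elim (1 - ε * ∑ i, a i) fun i => ε * a i, fun _ => zero_le, by
      rw [Fintype.sum_option]
      simp only [Option.elim_none, Option.elim_some, ← Finset.mul_sum]
      exact tsub_add_cancel_of_le h1.le⟩
  have hfin : fDivergence (separable π φ) P β ≠ ⊤ := by
    rw [fDivergence_separable_eq]
    refine ENNReal.sum_ne_top.2 fun o _ => ?_
    cases o with
    | none =>
      simp only [β, P, Option.elim_none]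
      rw [perspective_of_ne_zero (tsub_pos_of_lt h1).ne']
      exact ENNReal.mul_ne_top (by simp) (separable_ne_top_of_mem_Icc hφ hr' hs' h3)
    | some i =>
      simp only [β, P, Option.elim_some]
      have := perspective_smul hφ hπ hε (a i) (x i)
      change perspective π φ (ε * a i) (ε • x i) ≠ ⊤
      rw [this]
      exact ENNReal.mul_ne_top (by simp) (hx i)
  obtain ⟨α, hα⟩ := exists_isOptimal hφ hπ hfin
  refine ⟨fun i => α.1 (some i), α.1 none, ?_, fun i => hl _ _ ?_, hl _ _ ?_, ?_⟩
  · have := α.2.2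
    rw [Fintype.sum_option] at this
    rw [add_comm]
    exact this
  · exact ⟨_, _, P, α, some i, hα, rfl, rfl⟩
  · exact ⟨_, _, P, α, none, hα, rfl, rfl⟩
  · obtain ⟨θ⟩ := hΘ
    exact fun h => (tsub_pos_of_lt (h2 θ)).ne' (congrFun h θ)

theorem exists_isTiltedMin_of_ne_top (hφ : IsCsiszarTransformation φ) (hπ : IsPrior π)
    (hnd : ∃ t : ℝ≥0, t ≠ 1 ∧ φ t ≠ ⊤) (hl : ∀ x a, IsOptimalPair π φ x a → IsTiltedMin π φ l x a)
    {x : Θ → ℝ≥0} {a : ℝ≥0} (hx : perspective π φ a x ≠ ⊤) : ∃ b, IsTiltedMin π φ l x b := by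
  obtain ⟨ε, ⟨α, z, -, h, -⟩, hε⟩ := ((eventually_exists_completion hφ hπ hnd hl (ι := Unit)
    (x := fun _ => x) (a := fun _ => a) fun _ => hx).and eventually_mem_nhdsWithin).exists
  have hε' : ε ≠ 0 := (mem_Ioi.1 hε).ne'
  refine ⟨ε⁻¹ * α (), ?_⟩
  have := (h ()).smul hφ hπ (inv_ne_zero hε')
  rwa [inv_smul_smul₀ hε'] at this

/-- Optimal reference probabilities are additive. -/
theorem sum_eq_sum_of_isTiltedMin (hφ : IsCsiszarTransformation φ) (hπ : IsPrior π)
    (hnd : ∃ t : ℝ≥0, t ≠ 1 ∧ φ t ≠ ⊤) (hl : ∀ x a, IsOptimalPair π φ x a → IsTiltedMin π φ l x a)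
    {ι κ : Type} [Fintype ι] [Fintype κ] {x : ι → Θ → ℝ≥0} {a : ι → ℝ≥0} {y : κ → Θ → ℝ≥0}
    {b : κ → ℝ≥0} (hx : ∀ i, IsTiltedMin π φ l (x i) (a i)) (hx0 : ∀ i, x i ≠ 0)
    (hy : ∀ j, IsTiltedMin π φ l (y j) (b j)) (hy0 : ∀ j, y j ≠ 0)
    (hsum : ∑ i, x i = ∑ j, y j) : ∑ i, a i = ∑ j, b j := by
  obtain ⟨ε, ⟨⟨α, z, h1, h2, h3, h0⟩, ⟨β, w, h1', h2', h3', -⟩⟩, hε⟩ :=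
    (((eventually_exists_completion hφ hπ hnd hl fun i => (hx i).1).and
      (eventually_exists_completion hφ hπ hnd hl fun i => (hy i).1)).and eventually_mem_nhdsWithin).exists
  have hε' : ε ≠ 0 := (mem_Ioi.1 hε).ne'
  -- Equal sums leave the same residual likelihoods, hence by uniqueness the same residual mass.
  -- Since all masses total one, the remaining sums agree.
  rw [← hsum] at h3'
  obtain rfl := h3.unique hφ hπ h0 h3'
  have hα : ∀ i, α i = ε * a i := fun i =>
    (h2 i).unique hφ hπ (smul_ne_zero hε' (hx0 i)) ((hx i).smul hφ hπ hε')
  have hβ : ∀ i, β i = ε * b i := fun i =>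
    (h2' i).unique hφ hπ (smul_ne_zero hε' (hy0 i)) ((hy i).smul hφ hπ hε')
  have h := add_right_cancel (h1.trans h1'.symm)
  simp only [hα, hβ, ← Finset.mul_sum] at h
  exact mul_left_cancel₀ hε' h

/-- The optimal reference probability is a linear function of the likelihoods. -/
theorem exists_linear_isTiltedMin (hφ : IsCsiszarTransformation φ) (hπ : IsPrior π)
    (hnd : ∃ t : ℝ≥0, t ≠ 1 ∧ φ t ≠ ⊤)
    (hl : ∀ x a, IsOptimalPair π φ x a → IsTiltedMin π φ l x a) :
    ∃ c : Θ → ℝ, ∑ θ, c θ = 1 ∧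
      ∀ x a, x ≠ 0 → IsTiltedMin π φ l x a → (a : ℝ) = ∑ θ, c θ * x θ := by
  classical
  obtain ⟨r, s, -, hs, -, hs'⟩ := hφ.exists_lt_one_lt hnd
  have hΘ : Nonempty Θ := by
    by_contra h
    rw [not_nonempty_iff] at h
    simpa using hπ.1.2
  have h1 : IsTiltedMin π φ l 1 1 := hl _ _ (isOptimalPair_one hφ)
  set δ := s - 1
  have hδ : 0 < δ := tsub_pos_of_lt hs
  have hδs : 1 + δ = s := add_tsub_cancel_of_le hs.le
  -- Unit vectors may have infinite cost. The vectors `1 + δ e_i` do not, since their entries lie in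
  -- `[1, s]`.
  let u : Θ → Θ → ℝ≥0 := fun i => 1 + Pi.single i δ
  have hu : ∀ i, ∃ b, IsTiltedMin π φ l (u i) b := fun i => by
    refine exists_isTiltedMin_of_ne_top hφ hπ hnd hl (a := 1) ?_
    rw [perspective_one]
    refine separable_ne_top_of_mem_Icc hφ (r := 1) (by simp [hφ.one]) hs' fun θ => ?_
    rcases eq_or_ne θ i with rfl | h
    · simp [u, hδs, hs.le]
    · simp [u, h, hs.le]
  choose b hb using hu
  have hne : ∀ v : Θ → ℝ≥0, (∀ θ, v θ ≠ 0) → v ≠ 0 := fun v hv h =>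
    hv hΘ.some (congrFun h _)
  have key : ∀ x a, x ≠ 0 → IsTiltedMin π φ l x a →
      ∑ θ, (1 + x θ) * b θ = δ * a + (∑ θ, (1 + x θ) + δ) := fun x a hx ha => by
    let e := Fintype.equivFin Θ
    -- Additivity is applied to `∑ (1 + x i) u i = δ x + (∑ (1 + x i) + δ) 1`. Weights `1 + x i`
    -- rather than `x i` keep every summand nonzero, and `Fin` replaces `Θ` because the index types
    -- must lie in `Type`.
    have h := sum_eq_sum_of_isTiltedMin hφ hπ hnd hl (ι := Fin (Fintype.card Θ)) (κ := Bool)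
      (x := fun i => (1 + x (e.symm i)) • u (e.symm i))
      (a := fun i => (1 + x (e.symm i)) * b (e.symm i))
      (y := fun o => bif o then δ • x else (∑ θ, (1 + x θ) + δ) • 1)
      (b := fun o => bif o then δ * a else (∑ θ, (1 + x θ) + δ) * 1)
      (fun i => (hb _).smul hφ hπ (by simp))
      (fun i => hne _ fun θ => by simp [u])
      (fun o => by
        cases o
        · exact h1.smul hφ hπ (by simp [hδ.ne'])
        · exact ha.smul hφ hπ hδ.ne')
      (fun o => by
        cases o
        · exact hne _ fun θ => by simp [hδ.ne']
        · exact smul_ne_zero hδ.ne' hx)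
      (by
        rw [e.symm.sum_comp fun i => (1 + x i) • u i, Fintype.sum_bool]
        funext θ
        simp only [u, smul_add, Finset.sum_add_distrib, Finset.sum_apply, Pi.add_apply,
          Pi.smul_apply, Pi.one_apply, smul_eq_mul, mul_one, cond_true, cond_false, Pi.single_apply,
          mul_ite, mul_zero, Finset.sum_ite_eq, Finset.mem_univ, if_true]
        ring)
    rw [e.symm.sum_comp fun i => (1 + x i) * b i, Fintype.sum_bool] at h
    simpa using h
  have hδ' : (δ : ℝ) ≠ 0 := by exact_mod_cast hδ.ne'
  have key' : ∀ x a, x ≠ 0 → IsTiltedMin π φ l x a →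
      (a : ℝ) = ∑ θ, (b θ - 1 : ℝ) / δ * x θ + (∑ θ, (b θ - 1 : ℝ) / δ - 1) := fun x a hx ha => by
    have h := congrArg (fun y : ℝ≥0 => (y : ℝ)) (key x a hx ha)
    push_cast at h
    have e : ∑ θ, ((b θ : ℝ) - 1) / δ * x θ + ∑ θ, (b θ - 1 : ℝ) / δ =
        (∑ θ, (1 + (x θ : ℝ)) * b θ - ∑ θ, (1 + (x θ : ℝ))) / δ := by
      rw [← Finset.sum_add_distrib, ← Finset.sum_sub_distrib, Finset.sum_div]
      exact Finset.sum_congr rfl fun θ _ => by ring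
    rw [← add_sub_assoc, e, h]
    field_simp
    ring
  -- At `x = 1`, `a = 1` the affine formula reads `1 = 2 ∑ c - 1`, so its constant term vanishes.
  have hc : ∑ θ, (b θ - 1 : ℝ) / δ = 1 := by
    have h := key' 1 1 (hne _ fun _ => by simp) h1
    simp only [NNReal.coe_one, Pi.one_apply, mul_one] at h
    linarith
  refine ⟨fun θ => (b θ - 1 : ℝ) / δ, hc, fun x a hx ha => ?_⟩
  rw [key' x a hx ha, hc]
  ring

end TiltedMin

/-! ### Lagrange multipliers on a level set and the equation `ψ'' = k ψ'` -/

section Multipliers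

theorem hasStrictFDerivAt_sum_comp {Θ : Type*} [Fintype Θ] {g g' : ℝ → ℝ} (p v : Θ → ℝ)
    (hg : ∀ t, HasStrictDerivAt g (g' t) t) :
    HasStrictFDerivAt (fun v : Θ → ℝ => ∑ θ, p θ * g (v θ))
      (∑ θ, (p θ * g' (v θ)) • (ContinuousLinearMap.proj θ : (Θ → ℝ) →L[ℝ] ℝ)) v := by
  refine HasStrictFDerivAt.fun_sum fun θ _ => ?_
  have h := ((hg (v θ)).const_mul (p θ)).comp_hasStrictFDerivAt v
    (ContinuousLinearMap.proj θ : (Θ → ℝ) →L[ℝ] ℝ).hasStrictFDerivAt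
  exact h

/-- Near `v` the sum `∑ c θ * ψ' (v θ)` is constant on the level set, so `v` is a constrained
extremum. The multiplier of the objective is nonzero because the gradient of the constraint does not
vanish in coordinate `i`. -/
theorem exists_multiplier {Θ : Type*} [Fintype Θ] {ψ : ℝ → ℝ} (hψ : ContDiff ℝ 2 ψ)
    {p c : Θ → ℝ} (hp : ∀ θ, 0 < p θ) {l m : ℝ}
    (h : ∀ v : Θ → ℝ, ∑ θ, p θ * ψ (v θ) = l → (∃ i, deriv ψ (v i) ≠ 0) →
      ∑ θ, c θ * deriv ψ (v θ) = m)
    {v : Θ → ℝ} (hv : ∑ θ, p θ * ψ (v θ) = l) (hne : ∃ i, deriv ψ (v i) ≠ 0) :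
    ∃ μ : ℝ, ∀ θ, c θ * deriv (deriv ψ) (v θ) = μ * (p θ * deriv ψ (v θ)) := by
  classical
  have hψ' : ContDiff ℝ 1 (deriv ψ) := ((contDiff_succ_iff_deriv (n := 1)).1 hψ).2.2
  have h1 : ∀ t, HasStrictDerivAt ψ (deriv ψ t) t := fun t =>
    hψ.contDiffAt.hasStrictDerivAt (by norm_num)
  have h2 : ∀ t, HasStrictDerivAt (deriv ψ) (deriv (deriv ψ) t) t := fun t =>
    hψ'.contDiffAt.hasStrictDerivAt (by norm_num)
  obtain ⟨i, hi⟩ := hne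
  have hextr : IsLocalExtrOn (fun w : Θ → ℝ => ∑ θ, c θ * deriv ψ (w θ))
      {w | ∑ θ, p θ * ψ (w θ) = ∑ θ, p θ * ψ (v θ)} v := by
    left
    have hnear : ∀ᶠ w : Θ → ℝ in 𝓝 v, deriv ψ (w i) ≠ 0 :=
      (hψ'.continuous.comp (continuous_apply i)).continuousAt.eventually_ne hi
    filter_upwards [nhdsWithin_le_nhds hnear, self_mem_nhdsWithin] with w hw hw'
    rw [h v hv ⟨i, hi⟩, h w (hw'.trans hv) ⟨i, hw⟩]
  obtain ⟨a, b, hab, heq⟩ := hextr.exists_multipliers_of_hasStrictFDerivAt_1d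
    (hasStrictFDerivAt_sum_comp p v h1) (hasStrictFDerivAt_sum_comp c v h2)
  have hcoord : ∀ θ, a * (p θ * deriv ψ (v θ)) + b * (c θ * deriv (deriv ψ) (v θ)) = 0 := fun θ => by
    have := DFunLike.congr_fun heq (Pi.single θ 1)
    simpa [sum_apply, Pi.single_apply] using this
  have hb : b ≠ 0 := by
    rintro rfl
    have := hcoord i
    simp only [zero_mul, add_zero, mul_eq_zero, (hp i).ne', hi, or_false] at this
    exact hab (by simp [this])
  refine ⟨-a / b, fun θ => ?_⟩
  field_simp
  linarith [hcoord θ]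

/-- Both `ψ' x * exp (-k (x - a))` and `k ψ - ψ'` have zero derivative. -/
theorem deriv_eq_exp_of_Icc {ψ : ℝ → ℝ} (hψ : ContDiff ℝ 2 ψ) {a b k : ℝ}
    (h : ∀ x ∈ Icc a b, deriv (deriv ψ) x = k * deriv ψ x) {x : ℝ} (hx : x ∈ Icc a b) :
    deriv ψ x = deriv ψ a * Real.exp (k * (x - a)) ∧
      k * ψ x - deriv ψ x = k * ψ a - deriv ψ a := by
  have hψ' : ContDiff ℝ 1 (deriv ψ) := ((contDiff_succ_iff_deriv (n := 1)).1 hψ).2.2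
  have h1 : ∀ t, HasDerivAt ψ (deriv ψ t) t := fun t =>
    (hψ.differentiable (by norm_num) t).hasDerivAt
  have h2 : ∀ t, HasDerivAt (deriv ψ) (deriv (deriv ψ) t) t := fun t =>
    (hψ'.differentiable (by norm_num) t).hasDerivAt
  constructor
  · have hd : ∀ t, HasDerivAt (fun t => deriv ψ t * Real.exp (-(k * (t - a))))
        (deriv (deriv ψ) t * Real.exp (-(k * (t - a))) +
          deriv ψ t * (Real.exp (-(k * (t - a))) * -(k * 1))) t := fun t =>
      (h2 t).mul ((((hasDerivAt_id t).sub_const a).const_mul k).neg.exp)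
    have hconst := constant_of_has_deriv_right_zero (a := a) (b := b)
      (f := fun t => deriv ψ t * Real.exp (-(k * (t - a))))
      (fun t _ => (hd t).continuousAt.continuousWithinAt)
      (fun t ht => by
        have := (hd t).hasDerivWithinAt (s := Ici t)
        rw [h t ⟨ht.1, ht.2.le⟩] at this
        convert this using 1
        ring) x hx
    simp only [sub_self, mul_zero, neg_zero, Real.exp_zero, mul_one] at hconst
    rw [← hconst, mul_assoc, ← Real.exp_add, neg_add_cancel, Real.exp_zero, mul_one]
  · exact constant_of_has_deriv_right_zero (a := a) (b := b)
      (f := fun t => k * ψ t - deriv ψ t)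
      (fun t _ => (((h1 t).const_mul k).sub (h2 t)).continuousAt.continuousWithinAt)
      (fun t ht => by
        have := (((h1 t).const_mul k).sub (h2 t)).hasDerivWithinAt (s := Ici t)
        rw [h t ⟨ht.1, ht.2.le⟩, sub_self] at this
        exact this) x hx

end Multipliers

/-! ### The conjugate is exponential on the relevant range -/

section Core

variable {Θ : Type*} [Fintype Θ] {π : Θ → ℝ≥0} {φ : ℝ≥0 → ℝ≥0∞}

/-- If the conjugate has an exponential left tail from a point `l` with `ψ l = l`, its rate is
positive. -/
theorem IsCsiszarTransformation.rate_pos (hφ : IsCsiszarTransformation φ)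
    (hnd : ∃ t : ℝ≥0, t ≠ 1 ∧ φ t ≠ ⊤) (hd : Differentiable ℝ (psi φ)) {l k : ℝ}
    (hl : psi φ l = l) (h : ∀ t, 0 ≤ t → deriv (psi φ) (l - t) = Real.exp (-(k * t))) : 0 < k := by
  -- If `k ≤ 0` then `ψ' ≥ 1` to the left of `l`, so `ψ (l - t) ≤ l - t`. Fenchel–Young at a point
  -- `r < 1` of the domain then bounds `(1 - r) t`, which is absurd for large `t`.
  by_contra! hk
  obtain ⟨r, -, hr, -, hr', -⟩ := hφ.exists_lt_one_lt hnd
  have hr1 : (r : ℝ) < 1 := by exact_mod_cast hr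
  have hle : ∀ t, 0 ≤ t → psi φ (l - t) ≤ l - t := fun t ht => by
    have := (convex_Icc (l - t) l).mul_sub_le_image_sub_of_le_deriv (f := psi φ) (C := 1)
      hd.continuous.continuousOn hd.differentiableOn (fun x hx => by
        rw [interior_Icc] at hx
        have := h (l - x) (by linarith [hx.2])
        rw [sub_sub_cancel] at this
        rw [this]
        refine Real.one_le_exp ?_
        nlinarith [hx.2]) (l - t) ⟨le_rfl, by linarith⟩ l ⟨by linarith, le_rfl⟩ (by linarith)
    linarith
  obtain ⟨t, ht⟩ := exists_gt (max 0 (((φ r).toReal + l * (1 - r)) / (1 - r)))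
  have ht0 := (le_max_left _ _).trans_lt ht
  have ht1 := (le_max_right _ _).trans_lt ht
  rw [div_lt_iff₀ (by linarith)] at ht1
  have h1 := hφ.young (l - t) hr'
  have h2 := hle t ht0.le
  nlinarith

/-- The constant vector `l` yields `c θ * k = μ₀ * π θ`, and summation gives `μ₀ = k`. State `i`,
with `c i ≠ 0`, is lowered to `l - t`, state `m` compensates, and state `j` stays at `l`, where it
forces the multiplier to remain `μ₀`. Coordinate `i` then gives the differential equation. -/
theorem exists_eq_of_linear_level {l : ℝ} {c : Θ → ℝ} (hφ : IsCsiszarTransformation φ)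
    (hπ : IsPrior π) (hΘ : 3 ≤ Fintype.card Θ) (hnd : ∃ t : ℝ≥0, t ≠ 1 ∧ φ t ≠ ⊤)
    (hψ : ContDiff ℝ 2 (psi φ)) (hl : psi φ l = l) (hc : ∑ θ, c θ = 1)
    (h : ∀ v : Θ → ℝ, ∑ θ, (π θ : ℝ) * psi φ (v θ) = l → (∃ i, deriv (psi φ) (v i) ≠ 0) →
      ∑ θ, c θ * deriv (psi φ) (v θ) = 1) :
    0 < deriv (deriv (psi φ)) 0 ∧ (∀ θ, c θ = π θ) ∧ l = 0 ∧
      ∀ t ≤ 0, psi φ t = (Real.exp (deriv (deriv (psi φ)) 0 * t) - 1) / deriv (deriv (psi φ)) 0 ∧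
        deriv (psi φ) t = Real.exp (deriv (deriv (psi φ)) 0 * t) := by
  classical
  have hd : Differentiable ℝ (psi φ) := hψ.differentiable (by norm_num)
  have hp : ∀ θ, (0 : ℝ) < π θ := fun θ => by exact_mod_cast hπ.2 θ
  have hsum : ∑ θ, (π θ : ℝ) = 1 := by exact_mod_cast hπ.1.2
  have hdl : deriv (psi φ) l = 1 := hφ.deriv_eq_one hd hl
  have hself : ∀ t, t ≤ psi φ t := fun t => by
    simpa [hφ.one] using hφ.young t (s := 1) (by simp [hφ.one])
  have hmult := fun v => exists_multiplier hψ hp h (v := v)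
  set k := deriv (deriv (psi φ)) l with hk
  obtain ⟨i, -, hi⟩ : ∃ i ∈ Finset.univ, c i ≠ 0 :=
    Finset.exists_ne_zero_of_sum_ne_zero (by rw [hc]; exact one_ne_zero)
  obtain ⟨j, hj, m, hm, hjm⟩ := Finset.one_lt_card.1 (show 1 < (Finset.univ.erase i).card by
    rw [Finset.card_erase_of_mem (Finset.mem_univ i), Finset.card_univ]
    omega)
  have hji := Finset.ne_of_mem_erase hj
  have hmi := Finset.ne_of_mem_erase hm
  obtain ⟨μ₀, hμ₀⟩ : ∃ μ : ℝ, ∀ θ, c θ * k = μ * π θ := by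
    obtain ⟨μ, hμ⟩ := hmult (fun _ => l) (by rw [← Finset.sum_mul, hsum, one_mul, hl])
      ⟨i, by rw [hdl]; exact one_ne_zero⟩
    exact ⟨μ, fun θ => by simpa [hdl] using hμ θ⟩
  have hμk : k = μ₀ := by
    have := Finset.sum_congr rfl fun θ (_ : θ ∈ Finset.univ) => hμ₀ θ
    rwa [← Finset.sum_mul, ← Finset.mul_sum, hc, hsum, one_mul, mul_one] at this
  have hode : ∀ t, 0 ≤ t → deriv (deriv (psi φ)) (l - t) = k * deriv (psi φ) (l - t) := by
    intro t ht
    have hmono : psi φ (l - t) ≤ l := (hφ.monotone_psi hd (by linarith)).trans hl.le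
    -- `T` is the value that `ψ` must take at state `m` to restore the constraint. It is attained
    -- between `l` and `T` because `ψ l = l` and `T ≤ ψ T`.
    set T := l + π i / π m * (l - psi φ (l - t)) with hT
    have hlT : l ≤ T := le_add_of_nonneg_right
      (mul_nonneg (div_nonneg (hp i).le (hp m).le) (by linarith))
    obtain ⟨s, -, hs⟩ := intermediate_value_Icc hlT hd.continuous.continuousOn
      (⟨hl.le.trans hlT, hself T⟩ : T ∈ Icc (psi φ l) (psi φ T))
    have hv : ∀ θ, psi φ (if θ = i then l - t else if θ = m then s else l) =
        l + (if θ = i then psi φ (l - t) - l else 0) + (if θ = m then T - l else 0) := fun θ => by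
      by_cases h1 : θ = i
      · have : i ≠ m := hmi.symm
        simp [h1, this]
      · by_cases h2 : θ = m
        · simp [h2, hmi, hs]
        · simp [h1, h2, hl]
    obtain ⟨μ, hμ⟩ := hmult (fun θ => if θ = i then l - t else if θ = m then s else l) (by
        simp only [hv, mul_add, Finset.sum_add_distrib, ← Finset.sum_mul, hsum, mul_ite, mul_zero,
          Finset.sum_ite_eq', Finset.mem_univ, if_true]
        rw [hT]
        have := (hp m).ne'
        field_simp
        ring) ⟨j, by simp [hji, hjm, hdl]⟩
    have hμj := hμ j
    have hμi := hμ i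
    simp only [hji, hjm, if_false, if_true, hdl, mul_one, ← hk] at hμj hμi
    have : μ = μ₀ := mul_right_cancel₀ (hp j).ne' (hμj.symm.trans (hμ₀ j))
    rw [this, ← mul_assoc, ← hμ₀ i, mul_assoc] at hμi
    exact mul_left_cancel₀ hi hμi
  have hsol : ∀ t, 0 ≤ t → deriv (psi φ) (l - t) = Real.exp (-(k * t)) ∧
      k * psi φ (l - t) - deriv (psi φ) (l - t) = k * l - 1 := fun t ht => by
    obtain ⟨h1, h2⟩ := deriv_eq_exp_of_Icc hψ (a := l - t) (b := l) (k := k) (fun x hx => by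
      have := hode (l - x) (by linarith [hx.2])
      rwa [sub_sub_cancel] at this) (x := l) ⟨by linarith, le_rfl⟩
    rw [hdl] at h1
    rw [hdl, hl] at h2
    refine ⟨?_, h2.symm⟩
    rw [Real.exp_neg, sub_sub_cancel] at *
    exact eq_inv_of_mul_eq_one_left h1.symm
  have hkpos : 0 < k := hφ.rate_pos hnd hd hl fun t ht => (hsol t ht).1
  have hd0 : deriv (psi φ) 0 = 1 := hφ.deriv_eq_one hd hφ.psi_zero
  -- `ψ'` equals `1` both at `0` and at `l`. If `l < 0`, monotonicity makes `ψ'` constant on `[l,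
  -- 0]` and `k = 0`; if `l > 0`, the solution gives `ψ' 0 = exp (-k l) < 1`.
  have hl0 : l = 0 := by
    rcases lt_trichotomy l 0 with hneg | h0 | hpos
    · exfalso
      have hconst : ∀ x ∈ Icc l 0, deriv (psi φ) x = 1 := fun x hx =>
        le_antisymm (hd0 ▸ hφ.monotone_deriv hd hx.2) (hdl ▸ hφ.monotone_deriv hd hx.1)
      have hψ' : ContDiff ℝ 1 (deriv (psi φ)) := ((contDiff_succ_iff_deriv (n := 1)).1 hψ).2.2
      have h1 : HasDerivWithinAt (deriv (psi φ)) k (Icc l 0) l :=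
        (hψ'.differentiable (by norm_num) l).hasDerivAt.hasDerivWithinAt
      have h2 : HasDerivWithinAt (deriv (psi φ)) 0 (Icc l 0) l :=
        (hasDerivWithinAt_const l (Icc l 0) (1 : ℝ)).congr hconst hdl
      exact hkpos.ne' ((uniqueDiffOn_Icc hneg l ⟨le_rfl, hneg.le⟩).eq_deriv _ h1 h2)
    · exact h0
    · exfalso
      have := (hsol l hpos.le).1
      rw [sub_self, hd0] at this
      have h2 : Real.exp (-(k * l)) < 1 := by
        rw [← Real.exp_zero]
        exact Real.exp_lt_exp.2 (by nlinarith)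
      linarith
  have hk0 : deriv (deriv (psi φ)) 0 = k := by rw [hk, hl0]
  rw [hk0]
  refine ⟨hkpos, fun θ => ?_, hl0, fun t ht => ?_⟩
  · have := hμ₀ θ
    rw [← hμk, mul_comm] at this
    exact mul_left_cancel₀ hkpos.ne' this
  · obtain ⟨h1, h2⟩ := hsol (-t) (by linarith)
    rw [mul_neg, neg_neg] at h1
    rw [hl0, sub_neg_eq_add, zero_add] at h1 h2
    refine ⟨?_, h1⟩
    rw [h1] at h2
    field_simp
    linarith

/-- If the Csiszár cost is a sum over outcomes of a homogeneous function of the likelihoods, the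
conjugate is exponential on the range of arguments that are relevant at the prior. -/
theorem psi_eq_exp_of_isOutcomeAdditive (hφ : IsCsiszarTransformation φ)
    (hπ : IsPrior π) (hΘ : 3 ≤ Fintype.card Θ) (hnd : ∃ t : ℝ≥0, t ≠ 1 ∧ φ t ≠ ⊤)
    (hψ : ContDiff ℝ 2 (psi φ)) (hC : IsOutcomeAdditive (csiszarCost π φ)) :
    0 < deriv (deriv (psi φ)) 0 ∧ ∀ i t, deriv (deriv (psi φ)) 0 * t < Real.log (1 / π i) →
      psi φ t = (Real.exp (deriv (deriv (psi φ)) 0 * t) - 1) / deriv (deriv (psi φ)) 0 := by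
  classical
  have hd : Differentiable ℝ (psi φ) := hψ.differentiable (by norm_num)
  have hp : ∀ θ, (0 : ℝ) < π θ := fun θ => by exact_mod_cast hπ.2 θ
  have hsum : ∑ θ, (π θ : ℝ) = 1 := by exact_mod_cast hπ.1.2
  obtain ⟨l, hl⟩ := exists_isTiltedMin hφ hπ hnd hC
  obtain ⟨c, hc, hlin⟩ := exists_linear_isTiltedMin hφ hπ hnd hl
  have hlevel : ∀ v : Θ → ℝ, ∑ θ, (π θ : ℝ) * psi φ (v θ) = l →
      (∃ i, deriv (psi φ) (v i) ≠ 0) → ∑ θ, c θ * deriv (psi φ) (v θ) = 1 := by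
    rintro v hv ⟨i, hi⟩
    let x : Θ → ℝ≥0 := fun θ => ⟨deriv (psi φ) (v θ), hφ.deriv_nonneg hd _⟩
    have hx : x ≠ 0 := fun h => hi (congrArg NNReal.toReal (congrFun h i))
    have := hlin x 1 hx (isTiltedMin_of_deriv hφ hd hv fun θ => rfl)
    exact this.symm
  obtain ⟨hk, hcπ, rfl, hneg⟩ := exists_eq_of_linear_level hφ hπ hΘ hnd hψ
    ((hl _ _ (isOptimalPair_one hφ)).psi_eq hφ hπ) hc hlevel
  set k := deriv (deriv (psi φ)) 0
  refine ⟨hk, fun i t ht => ?_⟩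
  rcases le_total t 0 with ht0 | ht0
  · exact (hneg t ht0).1
  obtain ⟨j, hji⟩ := Fintype.exists_ne_of_one_lt_card (by omega) i
  have hπi : (π i : ℝ) < 1 := by
    rw [← hsum]
    exact Finset.single_lt_sum hji (Finset.mem_univ i) (Finset.mem_univ j) (hp j)
      fun θ _ _ => (hp θ).le
  -- With state `i` at `s` and all others at `u`, the constraint requires `ψ u = -π i * ψ s / (1 - π
  -- i)`. On the negative axis `ψ` exceeds `-1 / k`, and `ψ s < M` is exactly the condition for this
  -- value to be available.
  set M : ℝ := (1 - π i) / (π i * k)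
  have hd0 : deriv (psi φ) 0 = 1 := hφ.deriv_eq_one hd hφ.psi_zero
  have hode : ∀ s, 0 ≤ s → psi φ s < M → deriv (deriv (psi φ)) s = k * deriv (psi φ) s := by
    intro s hs hsM
    rw [lt_div_iff₀ (mul_pos (hp i) hk)] at hsM
    have h1π : (0 : ℝ) < 1 - π i := by linarith
    have hs0 : 0 ≤ psi φ s := hφ.psi_zero ▸ hφ.monotone_psi hd hs
    set q : ℝ := π i * psi φ s / (1 - π i) with hq
    have hq0 : 0 ≤ q := div_nonneg (mul_nonneg (hp i).le hs0) h1π.le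
    have hq1 : k * q < 1 := by
      rw [hq, mul_div_assoc', div_lt_one h1π]
      linarith
    have hpos : 0 < 1 - k * q := by linarith
    set u := Real.log (1 - k * q) / k with hu
    have hu0 : u ≤ 0 := div_nonpos_of_nonpos_of_nonneg
      (Real.log_nonpos hpos.le (by nlinarith)) hk.le
    obtain ⟨hu1, hu2⟩ := hneg u hu0
    have hku : Real.exp (k * u) = 1 - k * q := by
      rw [hu, mul_div_cancel₀ _ hk.ne', Real.exp_log hpos]
    have hψu : psi φ u = -q := by
      rw [hu1, hku]
      field_simp
      ring
    have hv : ∀ θ, psi φ (if θ = i then s else u) = -q + (if θ = i then psi φ s + q else 0) :=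
      fun θ => by split_ifs <;> simp [hψu]
    have hdu : deriv (psi φ) u ≠ 0 := by rw [hu2]; exact (Real.exp_pos _).ne'
    obtain ⟨μ, hμ⟩ := exists_multiplier hψ hp hlevel (v := fun θ => if θ = i then s else u) (by
        simp only [hv, mul_add, Finset.sum_add_distrib, ← Finset.sum_mul, hsum, mul_ite, mul_zero,
          Finset.sum_ite_eq', Finset.mem_univ, if_true]
        rw [hq]
        field_simp
        ring) ⟨j, by simpa [hji] using hdu⟩
    have hμj := hμ j
    have hμi := hμ i
    simp only [hji, if_false, if_true, hcπ] at hμj hμi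
    -- The exponential form is known only on `t ≤ 0` and `u` may be `0`, hence the one-sided
    -- derivative.
    have hddu : deriv (deriv (psi φ)) u = k * deriv (psi φ) u := by
      have hev : deriv (psi φ) =ᶠ[𝓝[≤] u] fun t => Real.exp (k * t) :=
        eventually_nhdsWithin_of_forall fun t ht => (hneg t (le_trans ht hu0)).2
      have hψ' : ContDiff ℝ 1 (deriv (psi φ)) := ((contDiff_succ_iff_deriv (n := 1)).1 hψ).2.2
      have h1 : HasDerivWithinAt (deriv (psi φ)) (deriv (deriv (psi φ)) u) (Iic u) u :=
        (hψ'.differentiable (by norm_num) u).hasDerivAt.hasDerivWithinAt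
      have h2 : HasDerivWithinAt (fun t => Real.exp (k * t)) (Real.exp (k * u) * (k * 1)) (Iic u) u :=
        (((hasDerivAt_id u).const_mul k).exp).hasDerivWithinAt
      have h3 := h2.congr_of_eventuallyEq hev hu2
      rw [(uniqueDiffWithinAt_Iic u).eq_deriv _ h1 h3, hu2]
      ring
    have hμk : μ = k := by
      rw [hddu] at hμj
      have : (π j : ℝ) * deriv (psi φ) u ≠ 0 := mul_ne_zero (hp j).ne' hdu
      refine mul_right_cancel₀ this ?_
      linarith
    rw [hμk] at hμi
    refine mul_left_cancel₀ (hp i).ne' ?_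
    linarith
  have hsol : ∀ s, 0 ≤ s → psi φ s < M → psi φ s = (Real.exp (k * s) - 1) / k := by
    intro s hs hsM
    obtain ⟨h1, h2⟩ := deriv_eq_exp_of_Icc hψ (a := 0) (b := s) (k := k) (fun x hx =>
      hode x hx.1 ((hφ.monotone_psi hd hx.2).trans_lt hsM)) (x := s) ⟨hs, le_rfl⟩
    rw [hd0, sub_zero, one_mul] at h1
    rw [h1, hd0, hφ.psi_zero] at h2
    field_simp
    linarith
  by_cases htM : psi φ t < M
  · exact hsol t ht0 htM
  exfalso
  push Not at htM
  -- `M` is the value of the exponential formula at `k t = log (1 / π i)`. If `ψ t ≥ M`, then `ψ`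
  -- takes, at some `s ≤ t`, a value strictly between the formula at `t` and `M`, which contradicts
  -- the formula at `s`.
  have htE : (Real.exp (k * t) - 1) / k < M := by
    have hE : Real.exp (k * t) < 1 / π i := by
      rwa [Real.lt_log_iff_exp_lt (one_div_pos.2 (hp i))] at ht
    have : M = (1 / π i - 1) / k := by
      have := (hp i).ne'
      simp only [M]
      field_simp
    rw [this]
    gcongr
  have hE0 : 0 ≤ (Real.exp (k * t) - 1) / k :=
    div_nonneg (sub_nonneg.2 (Real.one_le_exp (by positivity))) hk.le
  obtain ⟨w, hw1, hw2⟩ := exists_between htE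
  obtain ⟨s, hs, hsw⟩ := intermediate_value_Icc ht0 hd.continuous.continuousOn
    (⟨by rw [hφ.psi_zero]; linarith, by linarith⟩ : w ∈ Icc (psi φ 0) (psi φ t))
  have h1 := hsol s hs.1 (hsw ▸ hw2)
  have h2 : (Real.exp (k * s) - 1) / k ≤ (Real.exp (k * t) - 1) / k := by
    gcongr
    exact hs.2
  linarith

end Core

/-! ### Mutual information through `klFun`, and its posterior separability -/

section MutualInformation

variable {Θ Ω : Type*} [Fintype Θ] [Fintype Ω] {π : Θ → ℝ≥0} {φ : ℝ≥0 → ℝ≥0∞}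

theorem eq_zero_of_unconditional_eq_zero (hπ : IsPrior π) {P : Experiment Θ Ω} {ω : Ω}
    (h : unconditional π P ω = 0) (θ : Θ) : (P θ).1 ω = 0 := by
  have := (Finset.sum_eq_zero_iff.1 h) θ (Finset.mem_univ θ)
  exact (mul_eq_zero.1 this).resolve_left (hπ.2 θ).ne'

theorem sum_unconditional (hπ : IsPrior π) (P : Experiment Θ Ω) :
    ∑ ω, unconditional π P ω = 1 := by
  simp only [unconditional]
  rw [Finset.sum_comm]
  simp only [← Finset.mul_sum]
  rw [← hπ.1.2]
  refine Finset.sum_congr rfl fun θ _ => ?_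
  have : ∑ ω, (P θ).1 ω = 1 := (P θ).2.2
  rw [this, mul_one]

theorem div_unconditional_le (hπ : IsPrior π) (P : Experiment Θ Ω) (ω : Ω) (θ : Θ) :
    (P θ).1 ω / unconditional π P ω ≤ 1 / π θ := by
  rcases eq_or_ne (unconditional π P ω) 0 with h | h
  · simp [h]
  · rw [div_le_div_iff₀ (pos_iff_ne_zero.2 h) (hπ.2 θ), one_mul, mul_comm]
    exact Finset.single_le_sum (f := fun θ => π θ * (P θ).1 ω) (fun _ _ => zero_le)
      (Finset.mem_univ θ)

/-- Mutual information as a sum of nonnegative terms. -/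
theorem mutualInformation_eq_sum_klFun (hπ : IsPrior π) (P : Experiment Θ Ω) :
    mutualInformation π P = ∑ ω, (unconditional π P ω : ℝ) *
      ∑ θ, (π θ : ℝ) * klFun ((P θ).1 ω / unconditional π P ω) := by
  have hsum : ∑ θ, (π θ : ℝ) = 1 := by exact_mod_cast hπ.1.2
  simp only [mutualInformation, Finset.mul_sum]
  rw [Finset.sum_comm]
  refine Finset.sum_congr rfl fun ω _ => ?_
  rcases eq_or_ne (unconditional π P ω) 0 with h | h
  · simp [h]
  · have h' : (unconditional π P ω : ℝ) ≠ 0 := by exact_mod_cast h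
    -- The linear part `1 - x` of `klFun x = x log x + 1 - x` averages to zero over the states.
    have hterm : ∀ θ, (unconditional π P ω : ℝ) * (π θ * klFun ((P θ).1 ω / unconditional π P ω)) =
        π θ * ((P θ).1 ω * Real.log ((P θ).1 ω / unconditional π P ω)) +
          (π θ * unconditional π P ω - π θ * (P θ).1 ω) := fun θ => by
      rw [klFun_apply]
      field_simp
      ring
    have hu : ∑ θ, (π θ : ℝ) * (P θ).1 ω = unconditional π P ω := by
      simp [unconditional]
    rw [Finset.sum_congr rfl fun θ _ => hterm θ, Finset.sum_add_distrib, Finset.sum_sub_distrib,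
      ← Finset.sum_mul, hsum, hu, one_mul, sub_self, add_zero]

theorem sum_klFun_nonneg (P : Experiment Θ Ω) (ω : Ω) :
    0 ≤ ∑ θ, (π θ : ℝ) * klFun ((P θ).1 ω / unconditional π P ω) :=
  Finset.sum_nonneg fun θ _ => mul_nonneg (π θ).coe_nonneg
    (klFun_nonneg (div_nonneg (NNReal.coe_nonneg _) (NNReal.coe_nonneg _)))

theorem mutualInformation_nonneg (hπ : IsPrior π) (P : Experiment Θ Ω) :
    0 ≤ mutualInformation π P := by
  rw [mutualInformation_eq_sum_klFun hπ]
  exact Finset.sum_nonneg fun ω _ => mul_nonneg (NNReal.coe_nonneg _) (sum_klFun_nonneg P ω)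

/-- Some experiment has positive mutual information. -/
theorem exists_mutualInformation_pos (hπ : IsPrior π) (hΘ : 1 < Fintype.card Θ) :
    ∃ P : Experiment Θ Bool, 0 < mutualInformation π P := by
  classical
  have hsum : ∑ θ, (π θ : ℝ) = 1 := by exact_mod_cast hπ.1.2
  have hp : ∀ θ, (0 : ℝ) < π θ := fun θ => by exact_mod_cast hπ.2 θ
  obtain ⟨i, j, hij⟩ := Fintype.exists_pair_of_one_lt_card hΘ
  have hπi : (π i : ℝ) < 1 := by
    rw [← hsum]
    exact Finset.single_lt_sum hij.symm (Finset.mem_univ i) (Finset.mem_univ j) (hp j)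
      fun θ _ _ => (hp θ).le
  -- This experiment reveals whether the state is `i`.
  let P : Experiment Θ Bool := fun θ => ⟨fun o => if o = decide (θ = i) then 1 else 0,
    fun _ => zero_le, by simp⟩
  have hu : unconditional π P true = π i := by
    simp [unconditional, P]
  refine ⟨P, ?_⟩
  rw [mutualInformation_eq_sum_klFun hπ]
  refine Finset.sum_pos' (fun ω _ => mul_nonneg (NNReal.coe_nonneg _) (sum_klFun_nonneg P ω))
    ⟨true, Finset.mem_univ _, ?_⟩
  rw [hu]
  refine mul_pos (hp i) (Finset.sum_pos' (fun θ _ => mul_nonneg (hp θ).le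
    (klFun_nonneg (div_nonneg (NNReal.coe_nonneg _) (NNReal.coe_nonneg _))))
    ⟨i, Finset.mem_univ _, mul_pos (hp i) ?_⟩)
  have hPi : (P i).1 true = 1 := by simp [P]
  rw [hPi]
  have h0 : (0 : ℝ) ≤ ((1 : ℝ≥0) : ℝ) / π i := by positivity
  refine lt_of_le_of_ne (klFun_nonneg h0) fun h => ?_
  have := (klFun_eq_zero_iff h0).1 h.symm
  rw [div_eq_one_iff_eq (hp i).ne'] at this
  push_cast at this
  linarith

theorem IsMultipleOfMutualInformation.eq_ofReal {κ : ℝ} (hκ : 0 < κ) (hπ : IsPrior π)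
    {C : CostFunction Θ} (h : IsMultipleOfMutualInformation π κ C) (Ω : Type) [Fintype Ω]
    (P : Experiment Θ Ω) : C Ω P = ENNReal.ofReal (κ * mutualInformation π P) := by
  have := h Ω P
  rw [← max_eq_left (mul_nonneg hκ.le (mutualInformation_nonneg hπ P)),
    ← EReal.coe_ennreal_ofReal] at this
  exact EReal.coe_ennreal_injective this

/-- On the simplex this is `κ` times the relative entropy of `p` with respect to `π`. Writing it
with `klFun` makes every summand nonnegative, hence representable in `[0, ∞]`. -/
theorem isEntropy_klFun {κ : ℝ} (hκ : 0 < κ) (hπ : IsPrior π) :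
    IsEntropy π fun p => ∑ θ, (π θ : ℝ≥0∞) * ENNReal.ofReal (κ * klFun (p θ / π θ)) where
  convex := by
    refine ⟨convex_stdSimplex _ _, fun p _ q _ a b _ _ hab => ?_⟩
    simp only [ENNReal.smul_def, smul_eq_mul, Finset.mul_sum]
    rw [← Finset.sum_add_distrib]
    refine Finset.sum_le_sum fun θ _ => ?_
    have hab' : (a : ℝ) + b = 1 := by exact_mod_cast hab
    have hconv := convexOn_klFun.2 (x := (p θ / π θ : ℝ)) (y := (q θ / π θ : ℝ))
      (mem_Ici.2 (by positivity)) (mem_Ici.2 (by positivity)) a.coe_nonneg b.coe_nonneg hab'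
    have e : ((a • p + b • q) θ : ℝ) / π θ = (a : ℝ) • (p θ / π θ : ℝ) + (b : ℝ) • (q θ / π θ : ℝ) := by
      simp only [Pi.add_apply, Pi.smul_apply, smul_eq_mul, NNReal.coe_add, NNReal.coe_mul]
      ring
    have hle : ENNReal.ofReal (κ * klFun (((a • p + b • q) θ : ℝ) / π θ)) ≤
        a * ENNReal.ofReal (κ * klFun (p θ / π θ)) + b * ENNReal.ofReal (κ * klFun (q θ / π θ)) := by
      have h1 : (0 : ℝ) ≤ κ * klFun (p θ / π θ) := mul_nonneg hκ.le (klFun_nonneg (by positivity))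
      have h2 : (0 : ℝ) ≤ κ * klFun (q θ / π θ) := mul_nonneg hκ.le (klFun_nonneg (by positivity))
      rw [← ENNReal.ofReal_coe_nnreal (p := a), ← ENNReal.ofReal_coe_nnreal (p := b),
        ← ENNReal.ofReal_mul a.coe_nonneg, ← ENNReal.ofReal_mul b.coe_nonneg,
        ← ENNReal.ofReal_add (mul_nonneg a.coe_nonneg h1) (mul_nonneg b.coe_nonneg h2)]
      refine ENNReal.ofReal_le_ofReal ?_
      rw [e]
      have := mul_le_mul_of_nonneg_left hconv hκ.le
      simp only [smul_eq_mul] at this ⊢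
      linarith
    calc _ ≤ (π θ : ℝ≥0∞) * (a * ENNReal.ofReal (κ * klFun (p θ / π θ)) +
          b * ENNReal.ofReal (κ * klFun (q θ / π θ))) := mul_le_mul_right hle _
      _ = _ := by ring
  lsc := by
    refine Continuous.lowerSemicontinuous ?_ |>.lowerSemicontinuousOn _
    refine continuous_finsetSum _ fun θ _ => (ENNReal.continuous_const_mul (by simp)).comp ?_
    refine ENNReal.continuous_ofReal.comp (continuous_const.mul (continuous_klFun.comp ?_))
    fun_prop
  prior := by
    refine Finset.sum_eq_zero fun θ _ => ?_
    have : (π θ : ℝ) ≠ 0 := by exact_mod_cast (hπ.2 θ).ne'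
    rw [div_self this, klFun_one]
    simp

theorem ofReal_mul_sum_klFun {κ : ℝ} (hκ : 0 < κ) (c : ℝ≥0) {s : Θ → ℝ} (hs : ∀ θ, 0 ≤ s θ) :
    ENNReal.ofReal (κ * (c * ∑ θ, (π θ : ℝ) * klFun (s θ))) =
      c * ∑ θ, (π θ : ℝ≥0∞) * ENNReal.ofReal (κ * klFun (s θ)) := by
  have hn : ∀ θ, 0 ≤ κ * klFun (s θ) := fun θ => mul_nonneg hκ.le (klFun_nonneg (hs θ))
  have e : κ * (c * ∑ θ, (π θ : ℝ) * klFun (s θ)) = c * ∑ θ, (π θ : ℝ) * (κ * klFun (s θ)) := by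
    rw [mul_left_comm, Finset.mul_sum]
    congr 1
    exact Finset.sum_congr rfl fun θ _ => by ring
  rw [e, ENNReal.ofReal_mul c.coe_nonneg, ENNReal.ofReal_coe_nnreal,
    ENNReal.ofReal_sum_of_nonneg fun θ _ => mul_nonneg (π θ).coe_nonneg (hn θ)]
  congr 1
  refine Finset.sum_congr rfl fun θ _ => ?_
  rw [ENNReal.ofReal_mul (π θ).coe_nonneg, ENNReal.ofReal_coe_nnreal]

theorem ofReal_mutualInformation {κ : ℝ} (hκ : 0 < κ) (hπ : IsPrior π) (P : Experiment Θ Ω) :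
    ENNReal.ofReal (κ * mutualInformation π P) = ∑ ω, (unconditional π P ω : ℝ≥0∞) *
      ∑ θ, (π θ : ℝ≥0∞) * ENNReal.ofReal (κ * klFun ((P θ).1 ω / unconditional π P ω)) := by
  rw [mutualInformation_eq_sum_klFun hπ, Finset.mul_sum, ENNReal.ofReal_sum_of_nonneg fun ω _ =>
    mul_nonneg hκ.le (mul_nonneg (NNReal.coe_nonneg _) (sum_klFun_nonneg P ω))]
  exact Finset.sum_congr rfl fun ω _ => ofReal_mul_sum_klFun hκ _ fun θ => by positivity

theorem IsMultipleOfMutualInformation.isPosteriorSeparable {κ : ℝ} (hκ : 0 < κ) (hπ : IsPrior π)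
    {C : CostFunction Θ} (h : IsMultipleOfMutualInformation π κ C) : IsPosteriorSeparable π C := by
  refine ⟨_, isEntropy_klFun hκ hπ, fun Ω _ P => ?_⟩
  rw [h.eq_ofReal hκ hπ, ofReal_mutualInformation hκ hπ, posteriorSeparableCost,
    Finset.sum_filter_of_ne (p := fun ω => unconditional π P ω ≠ 0)
      (fun ω _ h' h0 => h' (by simp [h0]))]
  refine Finset.sum_congr rfl fun ω _ => ?_
  congr 1
  refine Finset.sum_congr rfl fun θ _ => ?_
  congr 4
  have : (π θ : ℝ) ≠ 0 := by exact_mod_cast (hπ.2 θ).ne'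
  simp only [posterior, NNReal.coe_div, NNReal.coe_mul]
  field_simp

end MutualInformation

/-! ### From the exponential conjugate back to mutual information -/

section Exponential

variable {Θ : Type*} [Fintype Θ] {π : Θ → ℝ≥0} {φ : ℝ≥0 → ℝ≥0∞}

/-- Where the conjugate is exponential, `φ` is the generator of relative entropy. -/
theorem IsCsiszarTransformation.le_klFun (hφ : IsCsiszarTransformation φ)
    (hd : Differentiable ℝ (psi φ)) {κ : ℝ} (hκ : 0 < κ) {b : ℝ≥0} (hb : 0 < b)
    (h : ∀ t, t / κ < Real.log b → psi φ t = κ * (Real.exp (t / κ) - 1)) {s : ℝ≥0} (hs : s ≤ b) :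
    φ s ≤ ENNReal.ofReal (κ * klFun s) := by
  -- In the open interval `s = ψ' (κ log s)`, so equality in Fenchel–Young determines `φ s`.
  have hIoo : ∀ s ∈ Ioo 0 b, φ s = ENNReal.ofReal (κ * klFun s) := by
    intro s hs
    have hs0 : (0 : ℝ) < s := by exact_mod_cast hs.1
    have hlog : Real.log s < Real.log b := Real.log_lt_log hs0 (by exact_mod_cast hs.2)
    have ht : κ * Real.log s / κ = Real.log s := mul_div_cancel_left₀ _ hκ.ne'
    have hev : psi φ =ᶠ[𝓝 (κ * Real.log s)] fun t => κ * (Real.exp (t / κ) - 1) := by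
      have : ContinuousAt (fun t : ℝ => t / κ) (κ * Real.log s) := by fun_prop
      filter_upwards [this.eventually_lt_const (show κ * Real.log s / κ < Real.log b by rwa [ht])] with t ht'
      exact h t ht'
    have hder : deriv (psi φ) (κ * Real.log s) = s := by
      rw [hev.deriv_eq]
      have h1 : HasDerivAt (fun t => κ * (Real.exp (t / κ) - 1))
          (κ * (Real.exp (κ * Real.log s / κ) * (1 / κ))) (κ * Real.log s) :=
        ((((hasDerivAt_id _).div_const κ).exp).sub_const 1).const_mul κ
      rw [h1.deriv, ht, Real.exp_log hs0]
      field_simp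
    obtain ⟨r, hr, hr', heq⟩ := hφ.exists_deriv hd (κ * Real.log s)
    obtain rfl : s = r := NNReal.coe_injective (hder.symm.trans hr)
    rw [h _ (by rwa [ht]), ht, Real.exp_log hs0] at heq
    rw [← ENNReal.ofReal_toReal hr', klFun_apply]
    congr 1
    linarith
  -- The endpoints `0` and `b` are reached by lower semicontinuity, which yields only the
  -- inequality.
  have hcl : s ∈ closure (Ioo 0 b) := by
    rw [closure_Ioo hb.ne]
    exact ⟨zero_le, hs⟩
  have : (𝓝[Ioo 0 b] s).NeBot := mem_closure_iff_nhdsWithin_neBot.1 hcl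
  by_contra! hlt
  obtain ⟨d, hd1, hd2⟩ := exists_between hlt
  have hcont : Continuous fun s : ℝ≥0 => ENNReal.ofReal (κ * klFun s) :=
    ENNReal.continuous_ofReal.comp (continuous_const.mul
      (continuous_klFun.comp NNReal.continuous_coe))
  obtain ⟨r, ⟨h1, h2⟩, h3⟩ := (((hφ.lsc s d hd2).filter_mono (nhdsWithin_le_nhds (s := Ioo 0 b))).and
    ((hcont.continuousAt.eventually_lt_const hd1).filter_mono nhdsWithin_le_nhds)).and
      eventually_mem_nhdsWithin |>.exists
  rw [hIoo r h3] at h1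
  exact lt_asymm h1 h2

/-- If the conjugate is exponential on the arguments that are relevant at the prior, then the
Csiszár cost is a multiple of mutual information. -/
theorem isMultipleOfMutualInformation_of_psi (hφ : IsCsiszarTransformation φ) (hπ : IsPrior π)
    (hd : Differentiable ℝ (psi φ)) {κ : ℝ} (hκ : 0 < κ)
    (h : ∀ i t, t / κ < Real.log (1 / π i) → psi φ t = κ * (Real.exp (t / κ) - 1)) :
    IsMultipleOfMutualInformation π κ (csiszarCost π φ) := by
  classical
  intro Ω _ P
  have hp : ∀ θ, (0 : ℝ) < π θ := fun θ => by exact_mod_cast hπ.2 θ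
  have hsum : ∑ θ, (π θ : ℝ) = 1 := by exact_mod_cast hπ.1.2
  have hπ1 : ∀ θ, (π θ : ℝ) ≤ 1 := fun θ => by
    rw [← hsum]
    exact Finset.single_le_sum (f := fun θ => (π θ : ℝ)) (fun θ _ => (hp θ).le) (Finset.mem_univ θ)
  -- Continuity adds the endpoint, which is needed when an outcome occurs in a single state and the
  -- ratio equals `1 / π i`.
  have hle : ∀ i t, t / κ ≤ Real.log (1 / π i) → psi φ t = κ * (Real.exp (t / κ) - 1) := by
    intro i t ht
    have hEq : EqOn (psi φ) (fun t => κ * (Real.exp (t / κ) - 1)) (Iio (κ * Real.log (1 / π i))) :=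
      fun t ht => h i t (by rw [div_lt_iff₀ hκ, mul_comm]; exact ht)
    have := hEq.closure hd.continuous (by fun_prop)
    rw [closure_Iio] at this
    exact this (by rw [div_le_iff₀ hκ, mul_comm] at ht; exact ht)
  have key : csiszarCost π φ Ω P = ENNReal.ofReal (κ * mutualInformation π P) := by
    refine le_antisymm ?_ (le_iInf fun α => ?_)
    -- Upper bound: the reference `P_π` is admissible and its likelihood ratios are at most `1 / π
    -- θ`, where `φ ≤ κ klFun`.
    · refine (iInf_le _ ⟨unconditional π P, fun _ => zero_le, sum_unconditional hπ P⟩).trans ?_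
      rw [ofReal_mutualInformation hκ hπ, fDivergence_separable_eq]
      refine Finset.sum_le_sum fun ω _ => ?_
      change perspective π φ (unconditional π P ω) _ ≤ _
      rcases eq_or_ne (unconditional π P ω) 0 with h0 | h0
      · have : (fun θ => (P θ).1 ω) = 0 := funext fun θ => eq_zero_of_unconditional_eq_zero hπ h0 θ
        rw [h0, this, perspective_zero_zero hφ]
        exact zero_le
      · rw [perspective_of_ne_zero h0]
        refine mul_le_mul_right (Finset.sum_le_sum fun θ _ => mul_le_mul_right ?_ _) _
        rw [← NNReal.coe_div]
        refine hφ.le_klFun hd hκ (b := 1 / π θ) (one_div_pos.2 (hπ.2 θ)) (fun t ht => h θ t ?_)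
          (div_unconditional_le hπ P ω θ)
        rwa [NNReal.coe_div, NNReal.coe_one] at ht
    · by_cases hfin : fDivergence (separable π φ) P α = ⊤
      · rw [hfin]
        exact le_top
      have hbound : ∀ n : ℕ, κ * mutualInformation π P - κ * Real.exp (-n) ≤
          (fDivergence (separable π φ) P α).toReal := by
        intro n
        -- The dual vector is `κ` times the log-likelihood ratio, truncated at `-κ n` where the
        -- likelihood vanishes; the truncation costs at most `κ exp (-n)`.
        let v : Ω → Θ → ℝ := fun ω θ => if (P θ).1 ω = 0 then -(κ * n) else
          κ * Real.log ((P θ).1 ω / unconditional π P ω)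
        have hψv : ∀ ω θ, psi φ (v ω θ) ≤
            κ * ((P θ).1 ω / unconditional π P ω - 1) + κ * Real.exp (-n) := by
          intro ω θ
          by_cases h0 : (P θ).1 ω = 0
          · have e : -(κ * n) / κ = -(n : ℝ) := by field_simp
            simp only [v, h0, if_true]
            rw [hle θ _ (by
              rw [e]
              have : 0 ≤ Real.log (1 / π θ) := Real.log_nonneg (by
                rw [le_div_iff₀ (hp θ), one_mul]
                exact hπ1 θ)
              have : (0 : ℝ) ≤ n := n.cast_nonneg
              linarith), e]
            simp only [NNReal.coe_zero, zero_div]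
            linarith
          · have hu0 : unconditional π P ω ≠ 0 := fun hu =>
              h0 (eq_zero_of_unconditional_eq_zero hπ hu θ)
            have hpos : (0 : ℝ) < (P θ).1 ω / unconditional π P ω := by
              have := pos_iff_ne_zero.2 h0
              have := pos_iff_ne_zero.2 hu0
              positivity
            have e : κ * Real.log ((P θ).1 ω / unconditional π P ω) / κ =
                Real.log ((P θ).1 ω / unconditional π P ω) := mul_div_cancel_left₀ _ hκ.ne'
            simp only [v, h0, if_false]
            rw [hle θ _ (by
              rw [e]
              refine Real.log_le_log hpos ?_
              have := div_unconditional_le hπ P ω θ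
              exact_mod_cast this), e, Real.exp_log hpos]
            have := Real.exp_pos (-(n : ℝ))
            nlinarith
        -- The coefficient of `α(ω)` in the dual bound is nearly nonpositive. Since `α` has total
        -- mass one, the resulting lower bound does not depend on `α`.
        have hmean : ∀ ω, ∑ θ, (π θ : ℝ) * psi φ (v ω θ) ≤ κ * Real.exp (-n) := by
          intro ω
          have h1 : ∑ θ, (π θ : ℝ) * ((P θ).1 ω / unconditional π P ω) ≤ 1 := by
            have : ∑ θ, (π θ : ℝ) * ((P θ).1 ω / unconditional π P ω) =
                unconditional π P ω / unconditional π P ω := by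
              simp only [mul_div_assoc', ← Finset.sum_div]
              simp [unconditional]
            rw [this]
            exact div_self_le_one _
          calc ∑ θ, (π θ : ℝ) * psi φ (v ω θ) ≤ ∑ θ, (π θ : ℝ) *
                (κ * ((P θ).1 ω / unconditional π P ω - 1) + κ * Real.exp (-n)) :=
                Finset.sum_le_sum fun θ _ => mul_le_mul_of_nonneg_left (hψv ω θ) (hp θ).le
            _ = κ * (∑ θ, (π θ : ℝ) * ((P θ).1 ω / unconditional π P ω)) - κ * ∑ θ, (π θ : ℝ) +
                (∑ θ, (π θ : ℝ)) * (κ * Real.exp (-n)) := by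
                rw [Finset.mul_sum, Finset.mul_sum, Finset.sum_mul, ← Finset.sum_sub_distrib,
                  ← Finset.sum_add_distrib]
                exact Finset.sum_congr rfl fun θ _ => by ring
            _ ≤ κ * Real.exp (-n) := by
                rw [hsum]
                nlinarith
        have hterm : ∀ ω, κ * (∑ θ, (π θ : ℝ) * ((P θ).1 ω *
            Real.log ((P θ).1 ω / unconditional π P ω))) - α.1 ω * (κ * Real.exp (-n)) ≤
            (perspective π φ (α.1 ω) fun θ => (P θ).1 ω).toReal := by
          intro ω
          have hne : perspective π φ (α.1 ω) (fun θ => (P θ).1 ω) ≠ ⊤ := by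
            rw [fDivergence_separable_eq] at hfin
            exact ENNReal.sum_ne_top.1 hfin ω (Finset.mem_univ ω)
          refine le_trans ?_ (le_toReal_perspective hφ (v ω) hne)
          have e : κ * (∑ θ, (π θ : ℝ) * ((P θ).1 ω *
              Real.log ((P θ).1 ω / unconditional π P ω))) =
              ∑ θ, (π θ : ℝ) * (v ω θ * (P θ).1 ω) := by
            rw [Finset.mul_sum]
            refine Finset.sum_congr rfl fun θ _ => ?_
            by_cases h0 : (P θ).1 ω = 0
            · simp [h0]
            · simp only [v, h0, if_false]
              ring
          rw [e]
          have := mul_le_mul_of_nonneg_left (hmean ω) (α.1 ω).coe_nonneg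
          linarith
        have hα : ∑ ω, (α.1 ω : ℝ) = 1 := by exact_mod_cast α.2.2
        rw [fDivergence_separable_eq] at hfin ⊢
        rw [ENNReal.toReal_sum fun ω hω => ENNReal.sum_ne_top.1 hfin ω hω]
        refine le_trans (le_of_eq ?_) (Finset.sum_le_sum fun ω _ => hterm ω)
        rw [Finset.sum_sub_distrib, ← Finset.sum_mul, hα, one_mul, ← Finset.mul_sum,
          Finset.sum_comm, mutualInformation]
        simp only [Finset.mul_sum]
      have hlim : Tendsto (fun n : ℕ => κ * mutualInformation π P - κ * Real.exp (-n)) atTop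
          (𝓝 (κ * mutualInformation π P - κ * 0)) :=
        ((Real.tendsto_exp_neg_atTop_nhds_zero.comp tendsto_natCast_atTop_atTop).const_mul
          κ).const_sub _
      rw [mul_zero, sub_zero] at hlim
      exact ENNReal.ofReal_le_of_le_toReal (le_of_tendsto' hlim hbound)
  rw [key, EReal.coe_ennreal_ofReal,
    max_eq_left (mul_nonneg hκ.le (mutualInformation_nonneg hπ P))]

/-- Priors with an arbitrarily small weight exist. -/
theorem exists_isPrior (hΘ : 1 < Fintype.card Θ) (i : Θ) {ε : ℝ≥0} (h0 : 0 < ε) (h1 : ε < 1) :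
    ∃ π : Θ → ℝ≥0, IsPrior π ∧ π i = ε := by
  classical
  have hn : (0 : ℝ≥0) < ((Fintype.card Θ - 1 : ℕ) : ℝ≥0) := by
    exact_mod_cast Nat.sub_pos_of_lt hΘ
  refine ⟨fun θ => if θ = i then ε else (1 - ε) / ((Fintype.card Θ - 1 : ℕ) : ℝ≥0),
    ⟨⟨fun _ => zero_le, ?_⟩, fun θ => ?_⟩, by simp⟩
  · rw [← Finset.add_sum_erase _ _ (Finset.mem_univ i), if_pos rfl,
      Finset.sum_congr rfl fun θ hθ => if_neg (Finset.ne_of_mem_erase hθ), Finset.sum_const,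
      Finset.card_erase_of_mem (Finset.mem_univ i), Finset.card_univ, nsmul_eq_mul,
      mul_div_cancel₀ _ hn.ne', add_tsub_cancel_of_le h1.le]
  · dsimp only
    split_ifs
    · exact h0
    · exact div_pos (tsub_pos_of_lt h1) hn

end Exponential

end RationalInattention

/-! ### The three equivalences -/

theorem mainTheorem2 {Θ : Type*} [Fintype Θ] (hΘ : 3 ≤ Fintype.card Θ)
    (φ : ℝ≥0 → ℝ≥0∞) (hφ : IsCsiszarTransformation φ)
    (hφ_nondegenerate : ∃ t : ℝ≥0, t ≠ 1 ∧ φ t ≠ ⊤)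
    (hψ : ContDiff ℝ 3 (psi φ)) :
    (∀ π : Θ → ℝ≥0, IsPrior π →
      (IsPosteriorSeparable π (csiszarCost π φ) ↔
        ∃ κ : ℝ, 0 < κ ∧ IsMultipleOfMutualInformation π κ (csiszarCost π φ))) ∧
    ((∀ π : Θ → ℝ≥0, IsPrior π → IsPosteriorSeparable π (csiszarCost π φ)) ↔
      ∃ κ : ℝ, 0 < κ ∧ ∀ t : ℝ, psi φ t = κ * (Real.exp (t / κ) - 1)) ∧
    (∀ κ : ℝ, 0 < κ →
      ((∀ π : Θ → ℝ≥0, IsPrior π → IsMultipleOfMutualInformation π κ (csiszarCost π φ)) ↔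
        ∀ t : ℝ, psi φ t = κ * (Real.exp (t / κ) - 1))) := by
  have hψ2 : ContDiff ℝ 2 (psi φ) := hψ.of_le (by norm_num)
  have hd : Differentiable ℝ (psi φ) := hψ2.differentiable (by norm_num)
  -- For `ψ t = κ (exp (t / κ) - 1)` one has `ψ'' 0 = 1 / κ`. So `k⁻¹` is the only candidate for
  -- `κ`, and it is the same for all priors.
  set k := deriv (deriv (psi φ)) 0
  have hcore : ∀ π : Θ → ℝ≥0, IsPrior π → IsPosteriorSeparable π (csiszarCost π φ) →
      0 < k⁻¹ ∧ ∀ i t, t / k⁻¹ < Real.log (1 / π i) →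
        psi φ t = k⁻¹ * (Real.exp (t / k⁻¹) - 1) := fun π hπ h => by
    obtain ⟨hk, hexp⟩ :=
      psi_eq_exp_of_isOutcomeAdditive hφ hπ hΘ hφ_nondegenerate hψ2 h.isOutcomeAdditive
    refine ⟨inv_pos.2 hk, fun i t ht => ?_⟩
    rw [div_inv_eq_mul, mul_comm t] at ht ⊢
    rw [hexp i t ht, div_eq_inv_mul]
  have hmult : ∀ κ : ℝ, 0 < κ → (∀ t : ℝ, psi φ t = κ * (Real.exp (t / κ) - 1)) →
      ∀ π : Θ → ℝ≥0, IsPrior π → IsMultipleOfMutualInformation π κ (csiszarCost π φ) :=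
    fun κ hκ h π hπ => isMultipleOfMutualInformation_of_psi hφ hπ hd hκ fun _ t _ => h t
  obtain ⟨i⟩ : Nonempty Θ := Fintype.card_pos_iff.1 (by omega)
  have hexp : (∀ π : Θ → ℝ≥0, IsPrior π → IsPosteriorSeparable π (csiszarCost π φ)) →
      0 < k⁻¹ ∧ ∀ t : ℝ, psi φ t = k⁻¹ * (Real.exp (t / k⁻¹) - 1) := fun h => by
    have key : ∀ t, 0 < k⁻¹ ∧ psi φ t = k⁻¹ * (Real.exp (t / k⁻¹) - 1) := fun t => by
      -- A prior with weight `exp (-r)` on state `i` has `log (1 / π i) = r > t / k⁻¹`, so its range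
      -- contains `t`.
      set r := |t / k⁻¹| + 1
      have hr : 0 < r := by positivity
      obtain ⟨π, hπ, hπi⟩ := exists_isPrior (Θ := Θ) (by omega) i
        (ε := ⟨Real.exp (-r), (Real.exp_pos _).le⟩) (Real.exp_pos (-r))
        (show Real.exp (-r) < 1 by
          rw [← Real.exp_zero]
          exact Real.exp_lt_exp.2 (by linarith))
      obtain ⟨h1, h2⟩ := hcore π hπ (h π hπ)
      refine ⟨h1, h2 i t ?_⟩
      rw [hπi]
      change _ < Real.log (1 / Real.exp (-r))
      rw [one_div, ← Real.exp_neg, neg_neg, Real.log_exp]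
      exact (le_abs_self _).trans_lt (lt_add_one _)
    exact ⟨(key 0).1, fun t => (key t).2⟩
  refine ⟨fun π hπ => ⟨fun h => ?_, ?_⟩, ⟨fun h => ⟨k⁻¹, hexp h⟩, ?_⟩,
    fun κ hκ => ⟨fun h => ?_, hmult κ hκ⟩⟩
  · obtain ⟨hk, hk'⟩ := hcore π hπ h
    exact ⟨k⁻¹, hk, isMultipleOfMutualInformation_of_psi hφ hπ hd hk hk'⟩
  · rintro ⟨κ, hκ, h⟩
    exact h.isPosteriorSeparable hκ hπ
  · rintro ⟨κ, hκ, h⟩ π hπ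
    exact (hmult κ hκ h π hπ).isPosteriorSeparable hκ hπ
  · obtain ⟨hk, hpsi⟩ := hexp fun π hπ => (h π hπ).isPosteriorSeparable hκ hπ
    obtain ⟨π, hπ, -⟩ := exists_isPrior (Θ := Θ) (by omega) i (ε := 1 / 2) (by positivity) (by
      rw [← NNReal.coe_lt_coe]
      norm_num)
    -- An experiment with positive mutual information, whose cost is both `κ` and `k⁻¹` times it,
    -- identifies `κ = k⁻¹`.
    obtain ⟨P, hP⟩ := exists_mutualInformation_pos hπ (by omega)
    have heq := (h π hπ Bool P).symm.trans (hmult k⁻¹ hk hpsi π hπ Bool P)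
    rw [EReal.coe_eq_coe_iff] at heq
    rwa [mul_right_cancel₀ hP.ne' heq]
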